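/- Let $E$ be a real $N\times N$ matrix all of whose complex eigenvalues have real part greater than $1$, let $E'$ be its transpose, $Q=\operatorname{trace}(E)$, and $r^E=\exp((\ln r)E)$ for $r>0$. There is a norm $\|\cdot\|_E$ on $\mathbb R^N$, with unit sphere $S_E=\{\theta:\|\theta\|_E=1\}$, such that $(r,\theta)\mapsto r^E\theta$ is a homeomorphism of $(0,\infty)\times S_E$ onto $\mathbb R^N\setminus\{0\}$. Fix any such norm; for $x\neq 0$ let $\tau_E(x)$ be the unique $r>0$ with $x=r^E\theta$ for some $\theta\in S_E$, and let $\tau_E(0)=0$. Let $\psi:\mathbb R^N\to[0,\infty)$ be continuous, symmetric ($\psi(-x)=\psi(x)$), with $\psi(x)>0$ and $\psi(r^{E'}x)=r\,\psi(x)$ for all $x\ne0$ and $r>0$. Let $X=\{X(t),\,t\in\mathbb R^N\}$ be the real-valued Gaussian random field, on any probability space, $$X(t)=\operatorname{Re}\int_{\mathbb R^N}\bigl(e^{i\langle t,\xi\rangle}-1\bigr)\frac{\widetilde{\mathcal M}(d\xi)}{\psi(\xi)^{1+Q/2}},\qquad t\in\mathbb R^N,$$ where $\widetilde{\mathcal M}$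 is a centered complex-valued Gaussian random measure on $\mathbb R^N$ with Lebesgue control measure $m_N$, i.e. a centered complex-valued Gaussian process indexed by the sets of finite Lebesgue measure with $\mathbb E\bigl(\widetilde{\mathcal M}(A)\overline{\widetilde{\mathcal M}(B)}\bigr)=m_N(A\cap B)$ and $\widetilde{\mathcal M}(-A)=\overline{\widetilde{\mathcal M}(A)}$ a.s., and the integral is the Wiener integral ($L^2$-limit of integrals of simple functions). Then there is a constant $C_5>0$, depending only on $E$, $\psi$ and the chosen norm, such that for all $n\ge 2$ and all $t^1,\dots,t^n\in\mathbb R^N$, with $t^0=0$, almost surely $$\operatorname{Var}\bigl(X(t^n)\,\big|\,X(t^1),\dots,X(t^{n-1})\bigr)\ \ge\ C_5\min_{0\le k\le n-1}\tau_E^2(t^n-t^k).$$ -/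

import Mathlib

open MeasureTheory ProbabilityTheory Filter Topology
open scoped ENNReal ComplexConjugate

namespace OperatorScaling

/-- The parameter space `ℝ^N` with its Euclidean norm. -/
abbrev Space (N : ℕ) : Type := EuclideanSpace ℝ (Fin N)

/-- The linear operator `r^E = exp ((log r) E) = ∑ₙ (log r)ⁿ Eⁿ / n!` on `ℝ^N`, for `r > 0`. -/
noncomputable def powOp {N : ℕ} (E : Matrix (Fin N) (Fin N) ℝ) (r : ℝ) : Space N →L[ℝ] Space N :=
  Matrix.toEuclideanCLM (𝕜 := ℝ) (n := Fin N) (NormedSpace.exp (Real.log r • E))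

/-- Every complex eigenvalue of the real matrix `E` has real part greater than `1`. -/
def EigenvaluesReGtOne {N : ℕ} (E : Matrix (Fin N) (Fin N) ℝ) : Prop :=
  ∀ μ : ℂ, Module.End.HasEigenvalue (Matrix.toLin' (E.map (fun x : ℝ => (x : ℂ)))) μ → 1 < μ.re

/-- The map `Ψ(r, θ) = r^E θ` on `(0, ∞) × S`, where `S = {θ : ν θ = 1}` is the unit sphere
of `ν`. -/
noncomputable def polarMap {N : ℕ} (E : Matrix (Fin N) (Fin N) ℝ) (ν : Seminorm ℝ (Space N)) :
    Set.Ioi (0 : ℝ) × {θ : Space N // ν θ = 1} → Space N :=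
  fun p => powOp E (p.1 : ℝ) (p.2 : Space N)

/-- `ν` is a norm on `ℝ^N` whose unit sphere gives polar coordinates for `E`: the map
`Ψ(r, θ) = r^E θ` is a homeomorphism of `(0, ∞) × S` onto `ℝ^N ∖ {0}`. -/
structure IsPolarNorm {N : ℕ} (E : Matrix (Fin N) (Fin N) ℝ) (ν : Seminorm ℝ (Space N)) : Prop where
  eq_zero_of_apply_eq_zero : ∀ x, ν x = 0 → x = 0
  isEmbedding_polarMap : IsEmbedding (polarMap E ν)
  range_polarMap : Set.range (polarMap E ν) = {0}ᶜ

open scoped Classical in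
/-- The radial part `τ_E` of the polar coordinates: for `x ≠ 0` the number `r > 0` (unique if `ν`
is a polar norm) with `x = r^E θ` for some `θ` with `ν θ = 1`; there is no such `r` for `x = 0`,
and `τ_E 0 = 0`. -/
noncomputable def tau {N : ℕ} (E : Matrix (Fin N) (Fin N) ℝ) (ν : Seminorm ℝ (Space N))
    (x : Space N) : ℝ :=
  if h : ∃ r : ℝ, 0 < r ∧ ∃ θ : Space N, ν θ = 1 ∧ powOp E r θ = x then h.choose else 0

/-- `ψ : ℝ^N → [0, ∞)` is continuous, symmetric, positive off the origin, and `E'`-homogeneous,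
where `E'` is the transpose of `E`. -/
structure IsSymmHomogeneous {N : ℕ} (E : Matrix (Fin N) (Fin N) ℝ) (ψ : Space N → ℝ) : Prop where
  continuous : Continuous ψ
  nonneg : ∀ x, 0 ≤ ψ x
  symm : ∀ x, ψ (-x) = ψ x
  pos : ∀ x, x ≠ 0 → 0 < ψ x
  homogeneous : ∀ r : ℝ, 0 < r → ∀ x, x ≠ 0 → ψ (powOp E.transpose r x) = r * ψ x

/-- The (Borel) sets of finite Lebesgue measure. -/
abbrev FiniteMeasureSet (N : ℕ) : Type :=
  {A : Set (Space N) // MeasurableSet A ∧ volume A < ∞}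

/-- `M` is a centered complex-valued Gaussian random measure on `ℝ^N` with Lebesgue control
measure: a process indexed by the sets of finite Lebesgue measure, centered and Gaussian (as a
process with values in the real vector space `ℂ`), with `𝔼 (M(A) conj M(B)) = m_N(A ∩ B)` and
`M(-A) = conj M(A)` almost surely. Values of `M` on other sets play no role. -/
structure IsGaussianRandomMeasure {N : ℕ} {Ω : Type*} [MeasurableSpace Ω] (P : Measure Ω)
    (M : Set (Space N) → Ω → ℂ) : Prop where
  gaussian : IsGaussianProcess (fun (A : FiniteMeasureSet N) (ω : Ω) => M A.1 ω) P
  centered : ∀ A : FiniteMeasureSet N, ∫ ω, M A.1 ω ∂P = 0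
  covariance : ∀ A B : FiniteMeasureSet N,
    ∫ ω, M A.1 ω * conj (M B.1 ω) ∂P = ((volume (A.1 ∩ B.1)).toReal : ℂ)
  hermitian : ∀ A : FiniteMeasureSet N,
    ∀ᵐ ω ∂P, M ((fun x : Space N => -x) ⁻¹' A.1) ω = conj (M A.1 ω)

/-- The integral `∑_c c M(f = c)` of a simple function `f = ∑_c c 1_{f = c}`. -/
noncomputable def simpleIntegral {N : ℕ} {Ω : Type*} (M : Set (Space N) → Ω → ℂ)
    (f : SimpleFunc (Space N) ℂ) (ω : Ω) : ℂ :=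
  ∑ c ∈ f.range, c * M (f ⁻¹' {c}) ω

/-- `Y` is (a version of) the Wiener integral `∫ f dM`: the limit in `L²(P)` of the integrals of
simple functions, supported on sets of finite Lebesgue measure, which converge to `f` in
`L²(ℝ^N)`. -/
def IsWienerIntegral {N : ℕ} {Ω : Type*} [MeasurableSpace Ω] (P : Measure Ω)
    (M : Set (Space N) → Ω → ℂ) (f : Space N → ℂ) (Y : Ω → ℂ) : Prop :=
  MemLp Y 2 P ∧ ∃ s : ℕ → SimpleFunc (Space N) ℂ,
    (∀ n, (s n).FinMeasSupp volume) ∧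
    Tendsto (fun n => eLpNorm (fun ξ => s n ξ - f ξ) 2 volume) atTop (𝓝 0) ∧
    Tendsto (fun n => eLpNorm (fun ω => simpleIntegral M (s n) ω - Y ω) 2 P) atTop (𝓝 0)

/-- The integrand `ξ ↦ (e^{i⟨t, ξ⟩} - 1) / ψ(ξ)^{1 + Q/2}`, with `Q = trace E`. -/
noncomputable def harmonizableKernel {N : ℕ} (E : Matrix (Fin N) (Fin N) ℝ) (ψ : Space N → ℝ)
    (t ξ : Space N) : ℂ :=
  (Complex.exp (Complex.I * ((inner ℝ t ξ : ℝ) : ℂ)) - 1) /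
    ((ψ ξ ^ (1 + E.trace / 2) : ℝ) : ℂ)

/-- `X` is the real-valued random field
`X(t) = Re ∫ (e^{i⟨t, ξ⟩} - 1) ψ(ξ)^{-1 - Q/2} M(dξ)`, `t ∈ ℝ^N`, where `M` is a centered
complex-valued Gaussian random measure with Lebesgue control measure. -/
def IsHarmonizableField {N : ℕ} {Ω : Type*} [MeasurableSpace Ω] (P : Measure Ω)
    (E : Matrix (Fin N) (Fin N) ℝ) (ψ : Space N → ℝ) (X : Space N → Ω → ℝ) : Prop :=
  (∀ t, Measurable (X t)) ∧
  ∃ M : Set (Space N) → Ω → ℂ, IsGaussianRandomMeasure P M ∧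
    ∀ t, ∃ Y : Ω → ℂ, IsWienerIntegral P M (harmonizableKernel E ψ t) Y ∧
      ∀ᵐ ω ∂P, X t ω = (Y ω).re

/-- The σ-algebra generated by the random variables `X(t¹), …, X(t^{n-1})`. -/
abbrev pastSigma {N : ℕ} {Ω : Type*} (X : Space N → Ω → ℝ) (t : ℕ → Space N) (n : ℕ) :
    MeasurableSpace Ω :=
  MeasurableSpace.comap (fun (ω : Ω) (k : Finset.Ico 1 n) => X (t k) ω) inferInstance

end OperatorScaling

namespace OperatorScaling

/-! ### Determinant, spectrum and decay of matrix exponentials. -/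

section MatrixExponential

open scoped Matrix.Norms.Operator

/-! Given finitely many values of a centered Gaussian process, the conditional variance of a further
value is not random: it is the squared `L²` distance to the span of the given values
(`condVar_ae_eq_of_isGaussianProcess`). The isometry of the Wiener integral turns it into the
distance, in `L²(dξ)`, from the kernel of `t^n` to the span of the kernels of `t^1, …, t^{n-1}`.
Taking real parts loses nothing, because the kernels and the random measure are Hermitian and the
integrals are therefore real (`IsWienerIntegral.ae_eq_re`).

The distance is bounded below by duality in `exists_mul_sq_le_integral_kernel`. Let `r` be the least
`τ(t^n - t^k)`, positive without loss of generality, and let `G` be a residual. Pick a Schwartz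
function `g` of integral `1` whose Fourier integral vanishes outside the `ε`-ball, and pair `G` with
`H(ξ) = ψ(ξ)^{1+Q/2} e^{-i⟨t^n,ξ⟩} g(r^{E'} ξ)`. The weight cancels, and each frequency `t^k`
contributes the Fourier integral of `g` at `r^{-E}(t^k - t^n)`, which is zero for `k < n`; the `-1`
in the kernels is the frequency `t^0 = 0`. So `∫ G H = r^{-Q}` whatever the coefficients, while
homogeneity gives `‖H‖² = K r^{-2-2Q}`. Cauchy–Schwarz yields `K ‖G‖² ≥ r²`.

The radius `ε` comes from `exists_le_norm_of_le_tau`: the operators `exp(-sE)`, `s ≥ 0`, are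
uniformly bounded, so expanding a unit vector cannot bring it near the origin. A polar norm is
obtained by averaging the Euclidean norm along the flow over a time `T` for which `exp(-TE)` halves
norms. -/

lemma hasDerivAt_det_exp_smul_zero {n : Type*} [Fintype n] [DecidableEq n] (A : Matrix n n ℝ) :
    HasDerivAt (fun s : ℝ => (NormedSpace.exp (s • A)).det) A.trace 0 := by
  have hentry : ∀ i j, HasDerivAt (fun s : ℝ => NormedSpace.exp (s • A) i j) (A i j) 0 := by
    intro i j
    have h := hasDerivAt_exp_smul_const A (0 : ℝ)
    have h2 := (LinearMap.toContinuousLinearMap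
      (Matrix.entryLinearMap ℝ ℝ i j)).hasFDerivAt.comp_hasDerivAt (0 : ℝ) h
    simpa [Function.comp_def, NormedSpace.exp_zero] using! h2
  simp only [Matrix.det_apply]
  have hsum := HasDerivAt.fun_sum (u := (Finset.univ : Finset (Equiv.Perm n))) (x := (0 : ℝ))
    (A := fun σ s => Equiv.Perm.sign σ • ∏ i, NormedSpace.exp (s • A) (σ i) i)
    (A' := fun σ => Equiv.Perm.sign σ • ∑ i, (∏ j ∈ Finset.univ.erase i,
      NormedSpace.exp ((0 : ℝ) • A) (σ j) j) • A (σ i) i)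
    (fun σ _ => by
      have := HasDerivAt.fun_finsetProd (u := (Finset.univ : Finset n)) (x := (0 : ℝ))
        (f := fun i s => NormedSpace.exp (s • A) (σ i) i) (f' := fun i => A (σ i) i)
        (fun i _ => hentry (σ i) i)
      simpa [Units.smul_def] using! this.const_smul ((Equiv.Perm.sign σ : ℤˣ) : ℤ))
  refine hsum.congr_deriv ?_
  -- A nontrivial permutation moves at least two indices, so after one factor is differentiated
  -- another off-diagonal entry of `exp 0 = 1` remains and kills the term.
  rw [Finset.sum_eq_single (1 : Equiv.Perm n)]
  · simp only [zero_smul, NormedSpace.exp_zero, Matrix.trace, Matrix.diag, Equiv.Perm.sign_one,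
      one_smul, Equiv.Perm.one_apply, Matrix.one_apply_eq, Finset.prod_const_one]
  · intro σ _ hσ
    rw [Finset.sum_eq_zero, smul_zero]
    intro i _
    obtain ⟨j, hji, hj⟩ : ∃ j, j ≠ i ∧ σ j ≠ j := by
      by_contra! h
      apply hσ
      ext j
      by_cases hji : j = i
      · subst hji
        by_contra hne
        exact hne (by simpa using h (σ j) (by simpa using hne))
      · simpa using h j hji
    rw [Finset.prod_eq_zero (i := j) (by simp [hji]), zero_smul]
    simp [NormedSpace.exp_zero, Matrix.one_apply_ne hj]
  · simp

lemma exp_add_smul {n : Type*} [Fintype n] [DecidableEq n] (A : Matrix n n ℝ) (s t : ℝ) :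
    NormedSpace.exp ((s + t) • A) = NormedSpace.exp (s • A) * NormedSpace.exp (t • A) := by
  rw [add_smul, Matrix.exp_add_of_commute]
  exact ((Commute.refl A).smul_left s).smul_right t

/-- Multiplicativity in `s` propagates the derivative at `0` to the equation `f' = (tr A) f`; hence
`f(s) e^{-s tr A}` is constant. -/
lemma det_exp_smul {n : Type*} [Fintype n] [DecidableEq n] (A : Matrix n n ℝ) (s : ℝ) :
    (NormedSpace.exp (s • A)).det = Real.exp (s * A.trace) := by
  set f : ℝ → ℝ := fun s => (NormedSpace.exp (s • A)).det with hf
  have hadd : ∀ s t, f (s + t) = f s * f t := fun s t => by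
    simp only [hf, exp_add_smul, Matrix.det_mul]
  have hderiv : ∀ s, HasDerivAt f (f s * A.trace) s := by
    intro s
    have h0 : HasDerivAt f A.trace (s - s) := by
      rw [sub_self]; exact hasDerivAt_det_exp_smul_zero A
    have h1 := (h0.comp_sub_const s s).const_mul (f s)
    refine h1.congr_of_eventuallyEq (Eventually.of_forall fun t => ?_)
    simp only [← hadd]; congr 1; ring
  have hconst : ∀ s, HasDerivAt (fun s => f s * Real.exp (-(s * A.trace))) 0 s := by
    intro s
    have h2 : HasDerivAt (fun s : ℝ => Real.exp (-(s * A.trace)))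
        (Real.exp (-(s * A.trace)) * (-(1 * A.trace))) s :=
      (((hasDerivAt_id s).mul_const A.trace).neg).exp
    exact ((hderiv s).mul h2).congr_deriv (by ring)
  have h := is_const_of_deriv_eq_zero (fun s => (hconst s).differentiableAt)
    (fun s => (hconst s).deriv) s 0
  have hf0 : f 0 = 1 := by simp [hf, NormedSpace.exp_zero]
  simp only [hf0, zero_mul, neg_zero, Real.exp_zero, mul_one] at h
  rw [Real.exp_neg] at h
  have := Real.exp_pos (s * A.trace)
  field_simp at h
  exact h

lemma exp_mulVec_of_mulVec_eq {n : Type*} [Fintype n] [DecidableEq n] (B : Matrix n n ℂ)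
    (v : n → ℂ) (μ : ℂ) (h : B.mulVec v = μ • v) :
    (NormedSpace.exp B).mulVec v = Complex.exp μ • v := by
  have hpow : ∀ k : ℕ, (B ^ k).mulVec v = μ ^ k • v := by
    intro k
    induction k with
    | zero => simp
    | succ k ih => rw [pow_succ, ← Matrix.mulVec_mulVec, h, Matrix.mulVec_smul, ih, smul_smul,
        pow_succ, mul_comm]
  have h1 := NormedSpace.exp_series_hasSum_exp' (𝕂 := ℂ) B
  have h2 := h1.mapL (LinearMap.toContinuousLinearMap
    (((Matrix.mulVecBilin ℂ ℂ).flip v : Matrix n n ℂ →ₗ[ℂ] (n → ℂ))))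
  have h3 := (NormedSpace.exp_series_hasSum_exp' (𝕂 := ℂ) μ).smul_const v
  rw [← Complex.exp_eq_exp_ℂ] at h3
  refine HasSum.unique (f := fun k : ℕ => ((k.factorial : ℂ)⁻¹ * μ ^ k) • v) ?_ (by simpa using h3)
  have h4 : ∀ k : ℕ, LinearMap.toContinuousLinearMap
      ((Matrix.mulVecBilin ℂ ℂ).flip v : Matrix n n ℂ →ₗ[ℂ] (n → ℂ))
      ((k.factorial : ℂ)⁻¹ • B ^ k) = ((k.factorial : ℂ)⁻¹ * μ ^ k) • v := fun k => by
    rw [LinearMap.coe_toContinuousLinearMap', LinearMap.flip_apply, Matrix.mulVecBilin_apply,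
      Matrix.smul_mulVec, hpow, smul_smul]
  simp only [h4] at h2
  exact h2

/-- An eigenvalue of `exp B` is the exponential of an eigenvalue of `B`. -/
lemma exists_eigenvalue_of_mem_spectrum_exp {n : Type*} [Fintype n] [DecidableEq n]
    (B : Matrix n n ℂ) {z : ℂ} (hz : z ∈ spectrum ℂ (NormedSpace.exp B)) :
    ∃ μ, Module.End.HasEigenvalue (Matrix.toLin' B) μ ∧ z = Complex.exp μ := by
  set f : Module.End ℂ (n → ℂ) := Matrix.toLin' (NormedSpace.exp B) with hf
  set g : Module.End ℂ (n → ℂ) := Matrix.toLin' B with hg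
  have hzf : f.HasEigenvalue z := by
    rw [Module.End.hasEigenvalue_iff_mem_spectrum]
    rw [hf, Matrix.spectrum_toLin']
    exact hz
  have hcomm : Commute f g := by
    have : Commute (NormedSpace.exp B) B := (Commute.refl B).exp_left
    rw [hf, hg, commute_iff_eq, Module.End.mul_eq_comp, Module.End.mul_eq_comp,
      ← Matrix.toLin'_mul, ← Matrix.toLin'_mul, this.eq]
  -- `B` commutes with `exp B`, so it preserves this eigenspace and has an eigenvector in it, on
  -- which `exp B` acts as `exp μ`.
  have hmaps : Set.MapsTo g (f.eigenspace z) (f.eigenspace z) :=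
    Module.End.mapsTo_genEigenspace_of_comm hcomm z 1
  have : Nontrivial (f.eigenspace z) := Submodule.nontrivial_iff_ne_bot.mpr hzf
  obtain ⟨μ, hμ⟩ := Module.End.exists_eigenvalue (g.restrict hmaps)
  obtain ⟨v, hv⟩ := hμ.exists_hasEigenvector
  have hgv : g v = μ • (v : n → ℂ) := by
    exact congrArg Subtype.val hv.apply_eq_smul
  have hv0 : (v : n → ℂ) ≠ 0 := fun h => hv.2 (Subtype.ext h)
  refine ⟨μ, Module.End.hasEigenvalue_of_hasEigenvector
    (Module.End.hasEigenvector_iff.mpr ⟨Module.End.mem_eigenspace_iff.mpr hgv, hv0⟩), ?_⟩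
  have h1 : f v = z • (v : n → ℂ) := Module.End.mem_eigenspace_iff.mp v.2
  have h2 : f v = Complex.exp μ • (v : n → ℂ) := exp_mulVec_of_mulVec_eq B v μ hgv
  exact smul_left_injective ℂ hv0 (h1.symm.trans h2)

/-- The eigenvalues of `exp(-B)` have modulus below `1`, and Gelfand's formula turns spectral radius
below `1` into geometric decay of the powers. -/
lemma tendsto_pow_exp_neg {n : Type*} [Fintype n] [DecidableEq n] [Nonempty n] (B : Matrix n n ℂ)
    (hB : ∀ μ : ℂ, Module.End.HasEigenvalue (Matrix.toLin' B) μ → 0 < μ.re) :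
    Tendsto (fun k : ℕ => NormedSpace.exp (-B) ^ k) atTop (𝓝 0) := by
  have hrad : spectralRadius ℂ (NormedSpace.exp (-B)) < (1 : NNReal) := by
    apply spectrum.spectralRadius_lt_of_forall_lt
    intro z hz
    obtain ⟨μ, hμ, rfl⟩ := exists_eigenvalue_of_mem_spectrum_exp _ hz
    have h2 : Module.End.HasEigenvalue (Matrix.toLin' B) (-μ) := by
      obtain ⟨v, hv⟩ := hμ.exists_hasEigenvector
      refine Module.End.hasEigenvalue_of_hasEigenvector (x := v)
        (Module.End.hasEigenvector_iff.mpr ⟨Module.End.mem_eigenspace_iff.mpr ?_, hv.2⟩)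
      have := hv.apply_eq_smul
      rw [map_neg, LinearMap.neg_apply] at this
      rw [neg_smul, ← this, neg_neg]
    have h3 := hB _ h2
    rw [← NNReal.coe_lt_coe, coe_nnnorm, Complex.norm_exp, NNReal.coe_one, Real.exp_lt_one_iff]
    simpa using h3
  obtain ⟨q, hq1, hq2⟩ := ENNReal.lt_iff_exists_nnreal_btwn.mp hrad
  have hq2' : q < 1 := by exact_mod_cast hq2
  have hev := (spectrum.pow_nnnorm_pow_one_div_tendsto_nhds_spectralRadius
    (NormedSpace.exp (-B))).eventually_lt_const hq1
  refine tendsto_zero_iff_norm_tendsto_zero.mpr ?_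
  refine squeeze_zero' (Eventually.of_forall fun k => norm_nonneg _) ?_
    (tendsto_pow_atTop_nhds_zero_of_lt_one q.2 hq2')
  filter_upwards [hev, eventually_gt_atTop 0] with k hk hk0
  have h1 : ((‖NormedSpace.exp (-B) ^ k‖₊ : ℝ≥0∞) ^ (1 / k : ℝ)) ^ (k : ℝ) ≤ (q : ℝ≥0∞) ^ (k : ℝ) :=
    ENNReal.rpow_le_rpow hk.le (by positivity)
  rw [← ENNReal.rpow_mul, one_div_mul_cancel (by positivity), ENNReal.rpow_one,
    ENNReal.rpow_natCast] at h1
  exact_mod_cast h1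

lemma tendsto_exp_neg_nat_smul {n : Type*} [Fintype n] [DecidableEq n] (E : Matrix n n ℝ)
    (hE : ∀ μ : ℂ, Module.End.HasEigenvalue
      (Matrix.toLin' (E.map (fun x : ℝ => (x : ℂ)))) μ → 0 < μ.re) :
    Tendsto (fun k : ℕ => NormedSpace.exp (-(k : ℝ) • E)) atTop (𝓝 0) := by
  rcases isEmpty_or_nonempty n with hn | hn
  · exact tendsto_const_nhds.congr fun k => Subsingleton.elim _ _
  have h := tendsto_pow_exp_neg _ hE
  have hmap : ∀ A : Matrix n n ℝ, (NormedSpace.exp A).map (fun x : ℝ => (x : ℂ)) =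
      NormedSpace.exp (A.map (fun x : ℝ => (x : ℂ))) := fun A =>
    NormedSpace.map_exp (Complex.ofRealHom.mapMatrix (m := n))
      (continuous_id.matrix_map Complex.continuous_ofReal) A
  have hre : ∀ k : ℕ, NormedSpace.exp (-(k : ℝ) • E) =
      (NormedSpace.exp (-(E.map (fun x : ℝ => (x : ℂ)))) ^ k).map Complex.re := by
    intro k
    have hcast : -(k : ℝ) • E = k • (-E) := by
      rw [neg_smul, smul_neg, Nat.cast_smul_eq_nsmul]
    have : -(E.map (fun x : ℝ => (x : ℂ))) = (-E).map (fun x : ℝ => (x : ℂ)) := by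
      ext; simp
    rw [this, ← Matrix.exp_nsmul, hcast]
    have h2 : k • (-E).map (fun x : ℝ => (x : ℂ)) = (k • (-E)).map (fun x : ℝ => (x : ℂ)) := by
      ext i j; simp [-nsmul_eq_mul, Matrix.smul_apply, Complex.ofReal_nsmul]
    rw [h2, ← hmap]
    ext; simp
  simp_rw [hre]
  have hc : Continuous fun M : Matrix n n ℂ => M.map Complex.re :=
    continuous_id.matrix_map Complex.continuous_re
  have := (hc.tendsto 0).comp h
  simpa [Function.comp_def] using! this

/-- The determinants `e^{-k tr E}` of `exp(-kE)` tend to `det 0`, which is `0` in positive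
dimension. -/
lemma trace_pos {n : Type*} [Fintype n] [DecidableEq n] [Nonempty n] (E : Matrix n n ℝ)
    (hE : ∀ μ : ℂ, Module.End.HasEigenvalue
      (Matrix.toLin' (E.map (fun x : ℝ => (x : ℂ)))) μ → 0 < μ.re) : 0 < E.trace := by
  have h := ((continuous_id (X := Matrix n n ℝ)).matrix_det.tendsto 0).comp (tendsto_exp_neg_nat_smul E hE)
  simp only [Function.comp_def, id, det_exp_smul, Matrix.det_zero] at h
  by_contra! hneg
  obtain ⟨k, hk⟩ := (h.eventually_lt_const zero_lt_one).exists
  rw [Real.exp_lt_one_iff] at hk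
  nlinarith [(Nat.cast_nonneg k : (0 : ℝ) ≤ k)]

end MatrixExponential

lemma continuous_seminorm {V : Type*} [NormedAddCommGroup V] [NormedSpace ℝ V]
    [FiniteDimensional ℝ V] (ν : Seminorm ℝ V) : Continuous ν := by
  rw [← continuousOn_univ]
  exact ν.convexOn.continuousOn isOpen_univ

/-! ### The one-parameter group of dilations and its change of variables. -/

section Flow

variable {N : ℕ} {E : Matrix (Fin N) (Fin N) ℝ}

/-- The one-parameter group `exp (s E)` on `ℝ^N`, so that `r^E` is its value at `log r`. -/
noncomputable def flow {N : ℕ} (E : Matrix (Fin N) (Fin N) ℝ) (s : ℝ) : Space N →L[ℝ] Space N :=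
  Matrix.toEuclideanCLM (𝕜 := ℝ) (n := Fin N) (NormedSpace.exp (s • E))

lemma powOp_eq_flow (r : ℝ) : powOp E r = flow E (Real.log r) := rfl

lemma flow_add (s t : ℝ) : flow E (s + t) = flow E s * flow E t := by
  simp only [flow, exp_add_smul, map_mul]

lemma flow_add_apply (s t : ℝ) (x : Space N) : flow E (s + t) x = flow E s (flow E t x) := by
  rw [flow_add]; rfl

@[simp] lemma flow_zero : flow E 0 = 1 := by
  simp [flow, NormedSpace.exp_zero]

@[simp] lemma flow_zero_apply (x : Space N) : flow E 0 x = x := by simp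

@[simp] lemma flow_neg_apply_flow (s : ℝ) (x : Space N) : flow E (-s) (flow E s x) = x := by
  rw [← flow_add_apply, neg_add_cancel, flow_zero_apply]

@[simp] lemma flow_apply_flow_neg (s : ℝ) (x : Space N) : flow E s (flow E (-s) x) = x := by
  rw [← flow_add_apply, add_neg_cancel, flow_zero_apply]

lemma continuous_toEuclideanCLM : Continuous (fun M : Matrix (Fin N) (Fin N) ℝ =>
    Matrix.toEuclideanCLM (𝕜 := ℝ) (n := Fin N) M) :=
  LinearMap.continuous_of_finiteDimensional
    ((Matrix.toEuclideanCLM (𝕜 := ℝ) (n := Fin N)).toAlgEquiv.toLinearMap)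

open scoped Matrix.Norms.Operator in
lemma continuous_flow : Continuous (flow E) := by
  have h : Continuous fun s : ℝ => NormedSpace.exp (s • E) :=
    (differentiable_exp_smul_const ℝ E).continuous
  exact continuous_toEuclideanCLM.comp h

lemma continuous_flow_apply : Continuous fun p : ℝ × Space N => flow E p.1 p.2 :=
  (continuous_flow.comp continuous_fst).clm_apply continuous_snd

lemma flow_transpose (s : ℝ) :
    flow E.transpose s = ContinuousLinearMap.adjoint (flow E s) := by
  rw [flow, flow, ← ContinuousLinearMap.star_eq_adjoint, ← map_star, Matrix.star_eq_conjTranspose,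
    Matrix.conjTranspose_eq_transpose_of_trivial, ← Matrix.exp_transpose, Matrix.transpose_smul]

lemma norm_flow_transpose (s : ℝ) : ‖flow E.transpose s‖ = ‖flow E s‖ := by
  rw [flow_transpose, LinearIsometryEquiv.norm_map]

lemma inner_flow (s : ℝ) (x y : Space N) :
    inner ℝ (flow E s x) y = inner ℝ x (flow E.transpose s y) := by
  rw [flow_transpose, ContinuousLinearMap.adjoint_inner_right]

lemma EigenvaluesReGtOne.exists_norm_flow_le_half (hE : EigenvaluesReGtOne E) :
    ∃ T > 0, ‖flow E (-T)‖ ≤ 1 / 2 := by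
  have h := (continuous_toEuclideanCLM.tendsto _).comp
    (tendsto_exp_neg_nat_smul E fun μ hμ => zero_lt_one.trans (hE μ hμ))
  rw [map_zero] at h
  have h2 := h.norm
  rw [norm_zero] at h2
  obtain ⟨k, hk, hk0⟩ :=
    ((h2.eventually_lt_const (by norm_num : (0 : ℝ) < 1 / 2)).and (eventually_gt_atTop 0)).exists
  exact ⟨k, by exact_mod_cast hk0, hk.le⟩

lemma flow_nat_mul (k : ℕ) (s : ℝ) : flow E (k * s) = flow E s ^ k := by
  induction k with
  | zero => simp
  | succ k ih => rw [Nat.cast_succ, add_mul, one_mul, flow_add, ih, pow_succ]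

lemma norm_flow_nat_mul_le {T : ℝ} (hT : ‖flow E (-T)‖ ≤ 1 / 2) (k : ℕ) :
    ‖flow E (-(k * T))‖ ≤ (1 / 2) ^ k := by
  rw [← mul_neg, flow_nat_mul]
  induction k with
  | zero => exact ContinuousLinearMap.norm_id_le
  | succ k ih =>
    rw [pow_succ, pow_succ]
    exact (norm_mul_le _ _).trans (mul_le_mul ih hT (norm_nonneg _) (by positivity))

/-- Whole periods `T` only contract, and the remaining time lies in a compact interval. -/
lemma EigenvaluesReGtOne.exists_norm_flow_neg_le (hE : EigenvaluesReGtOne E) :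
    ∃ C > 0, ∀ s, 0 ≤ s → ‖flow E (-s)‖ ≤ C := by
  obtain ⟨T, hT0, hT⟩ := hE.exists_norm_flow_le_half
  obtain ⟨C, hC⟩ := (isCompact_Icc (a := -T) (b := 0)).exists_bound_of_continuousOn
    (continuous_flow (E := E)).continuousOn
  refine ⟨max C 1, by positivity, fun s hs => ?_⟩
  set k := ⌊s / T⌋₊
  have h1 : (k : ℝ) * T ≤ s := by
    rw [← le_div_iff₀ hT0]; exact Nat.floor_le (by positivity)
  have h2 : s ≤ (k + 1) * T := by
    rw [← div_le_iff₀ hT0]; exact (Nat.lt_floor_add_one _).le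
  have h3 : -s = -(k * T) + (k * T - s) := by ring
  rw [h3, flow_add]
  refine (norm_mul_le _ _).trans ?_
  have h4 := hC (k * T - s) ⟨by linarith, by linarith⟩
  have h5 := norm_flow_nat_mul_le hT k
  have h6 : ((1 : ℝ) / 2) ^ k ≤ 1 := pow_le_one₀ (by norm_num) (by norm_num)
  calc _ ≤ 1 * C := mul_le_mul (h5.trans h6) h4 (norm_nonneg _) zero_le_one
    _ ≤ _ := by simp

lemma det_flow (s : ℝ) : (flow E s : Space N →ₗ[ℝ] Space N).det = Real.exp (s * E.trace) := by
  rw [flow, Matrix.coe_toEuclideanCLM_eq_toEuclideanLin]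
  change (Matrix.toLpLin 2 2 _).det = _
  rw [Matrix.toLpLin_eq_toLin, LinearMap.det_toLin, det_exp_smul]

lemma map_flow_volume (s : ℝ) : Measure.map (flow E s) (volume : Measure (Space N)) =
    ENNReal.ofReal (Real.exp (-(s * E.trace))) • volume := by
  have h := Measure.map_linearMap_addHaar_eq_smul_addHaar (volume : Measure (Space N))
    (f := (flow E s : Space N →ₗ[ℝ] Space N)) (by rw [det_flow]; positivity)
  rw [det_flow, ← Real.exp_neg, abs_of_pos (Real.exp_pos _)] at h
  exact h

lemma measurableEmbedding_flow (s : ℝ) : MeasurableEmbedding (flow E s) :=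
  (Homeomorph.mk (Equiv.mk (flow E s) (flow E (-s)) (fun x => by simp) (fun x => by simp))
    (flow E s).continuous (flow E (-s)).continuous).measurableEmbedding

lemma integral_comp_flow {F : Type*} [NormedAddCommGroup F] [NormedSpace ℝ F] (s : ℝ)
    (f : Space N → F) :
    ∫ x, f (flow E s x) = Real.exp (-(s * E.trace)) • ∫ x, f x := by
  rw [← (measurableEmbedding_flow s).integral_map, map_flow_volume, integral_smul_measure,
    ENNReal.toReal_ofReal (Real.exp_pos _).le]

lemma integrable_comp_flow {F : Type*} [NormedAddCommGroup F] (s : ℝ)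
    {f : Space N → F} (hf : Integrable f) : Integrable fun x => f (flow E s x) := by
  have h : Integrable f (Measure.map (flow E s) volume) := by
    rw [map_flow_volume]; exact hf.smul_measure ENNReal.ofReal_ne_top
  exact (measurableEmbedding_flow s).integrable_map_iff.mp h

end Flow

/-! ### Existence of a polar norm. -/

section PolarNorm

variable {N : ℕ} {E : Matrix (Fin N) (Fin N) ℝ}

/-- The seminorm `∫_0^T ‖exp (-s E) x‖ ds`. -/
noncomputable def averagedNorm (E : Matrix (Fin N) (Fin N) ℝ) {T : ℝ} (hT : 0 ≤ T) :
    Seminorm ℝ (Space N) :=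
  Seminorm.of (fun x => ∫ s in (0 : ℝ)..T, ‖flow E (-s) x‖)
    (fun x y => by
      have hc : ∀ x : Space N, IntervalIntegrable (fun s => ‖flow E (-s) x‖) volume 0 T := fun x =>
        (((continuous_flow.comp continuous_neg).clm_apply
          continuous_const).norm).intervalIntegrable _ _
      rw [← intervalIntegral.integral_add (hc x) (hc y)]
      refine intervalIntegral.integral_mono_on hT (hc _) ((hc x).add (hc y)) fun s _ => ?_
      rw [map_add]
      exact norm_add_le _ _)
    (fun a x => by
      simp_rw [map_smul, norm_smul]
      exact intervalIntegral.integral_const_mul _ _)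

lemma averagedNorm_apply {T : ℝ} (hT : 0 ≤ T) (x : Space N) :
    averagedNorm E hT x = ∫ s in (0 : ℝ)..T, ‖flow E (-s) x‖ := rfl

lemma continuous_norm_flow_neg (x : Space N) : Continuous fun s => ‖flow E (-s) x‖ :=
  ((continuous_flow.comp continuous_neg).clm_apply continuous_const).norm

/-- Applying the flow slides the window of integration to `[-u, T - u]`, which makes the derivative
in `u` accessible. -/
lemma averagedNorm_flow {T : ℝ} (hT : 0 ≤ T) (u : ℝ) (x : Space N) :
    averagedNorm E hT (flow E u x) = (∫ s in (0 : ℝ)..T - u, ‖flow E (-s) x‖) -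
      ∫ s in (0 : ℝ)..-u, ‖flow E (-s) x‖ := by
  have hc := fun a b => (continuous_norm_flow_neg (E := E) x).intervalIntegrable a b
    (μ := volume)
  rw [averagedNorm_apply]
  have h1 : ∀ s, flow E (-s) (flow E u x) = flow E (-(s - u)) x := fun s => by
    rw [← flow_add_apply]; congr 2; ring
  simp_rw [h1]
  rw [intervalIntegral.integral_comp_sub_right (fun s => ‖flow E (-s) x‖) u, zero_sub,
    intervalIntegral.integral_interval_sub_left (hc _ _) (hc _ _)]

lemma flow_ne_zero {x : Space N} (hx : x ≠ 0) (s : ℝ) : flow E s x ≠ 0 := fun h => hx (by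
  rw [← flow_neg_apply_flow (E := E) s x, h, map_zero])

/-- The derivative is the difference of the integrand at the ends of the window, `‖exp(uE) x‖ -
‖exp((u-T)E) x‖`, and the second term is at most half the first. -/
lemma strictMono_averagedNorm_flow {T : ℝ} (hT0 : 0 < T) (hT : ‖flow E (-T)‖ ≤ 1 / 2)
    {x : Space N} (hx : x ≠ 0) : StrictMono fun u => averagedNorm E hT0.le (flow E u x) := by
  have hcont := continuous_norm_flow_neg (E := E) x
  have hprim : ∀ b, HasDerivAt (fun b => ∫ s in (0 : ℝ)..b, ‖flow E (-s) x‖) ‖flow E (-b) x‖ b :=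
    fun b => intervalIntegral.integral_hasDerivAt_right (hcont.intervalIntegrable _ _)
      (hcont.stronglyMeasurableAtFilter _ _) hcont.continuousAt
  refine strictMono_of_hasDerivAt_pos
    (f' := fun u => ‖flow E (-(T - u)) x‖ * (-1) - ‖flow E (-(-u)) x‖ * (-1)) (fun u => ?_)
    fun u => ?_
  · simp_rw [averagedNorm_flow]
    exact ((hprim (T - u)).comp u ((hasDerivAt_id u).const_sub T)).sub
      ((hprim (-u)).comp u (hasDerivAt_neg u))
  · have h1 : flow E (-(T - u)) x = flow E (-T) (flow E u x) := by
      rw [← flow_add_apply]; congr 2; ring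
    have h2 : ‖flow E (-T) (flow E u x)‖ ≤ 1 / 2 * ‖flow E u x‖ :=
      ((flow E (-T)).le_opNorm _).trans (mul_le_mul_of_nonneg_right hT (norm_nonneg _))
    have h3 : 0 < ‖flow E u x‖ := norm_pos_iff.mpr (flow_ne_zero hx u)
    rw [h1, neg_neg]
    linarith

lemma averagedNorm_pos {T : ℝ} (hT0 : 0 < T) {x : Space N} (hx : x ≠ 0) :
    0 < averagedNorm E hT0.le x := by
  rw [averagedNorm_apply]
  exact intervalIntegral.intervalIntegral_pos_of_pos
    ((continuous_norm_flow_neg (E := E) x).intervalIntegrable _ _)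
    (fun s => norm_pos_iff.mpr (flow_ne_zero hx _)) hT0

lemma averagedNorm_flow_neg_le {T : ℝ} (hT0 : 0 < T) (hT : ‖flow E (-T)‖ ≤ 1 / 2) (x : Space N) :
    averagedNorm E hT0.le (flow E (-T) x) ≤ 1 / 2 * averagedNorm E hT0.le x := by
  rw [averagedNorm_apply, averagedNorm_apply, ← intervalIntegral.integral_const_mul]
  refine intervalIntegral.integral_mono_on hT0.le
    ((continuous_norm_flow_neg (E := E) _).intervalIntegrable _ _)
    (((continuous_norm_flow_neg (E := E) x).const_smul (1 / 2 : ℝ)).intervalIntegrable _ _)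
    fun s _ => ?_
  rw [← flow_add_apply, add_comm, flow_add_apply]
  exact ((flow E (-T)).le_opNorm _).trans (mul_le_mul_of_nonneg_right hT (norm_nonneg _))

lemma averagedNorm_flow_neg_nat_le {T : ℝ} (hT0 : 0 < T) (hT : ‖flow E (-T)‖ ≤ 1 / 2)
    (k : ℕ) (x : Space N) :
    averagedNorm E hT0.le (flow E (-(k * T)) x) ≤ (1 / 2) ^ k * averagedNorm E hT0.le x := by
  induction k with
  | zero => simp
  | succ k ih =>
    have : -(((k + 1 : ℕ) : ℝ) * T) = -T + -(k * T) := by push_cast; ring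
    rw [this, flow_add_apply, pow_succ]
    have := averagedNorm_flow_neg_le hT0 hT (flow E (-(k * T)) x)
    linarith

lemma continuous_averagedNorm {T : ℝ} (hT : 0 ≤ T) : Continuous (averagedNorm E hT) :=
  continuous_seminorm _

lemma exists_averagedNorm_flow_eq_one {T : ℝ} (hT0 : 0 < T) (hT : ‖flow E (-T)‖ ≤ 1 / 2)
    {x : Space N} (hx : x ≠ 0) : ∃ u, averagedNorm E hT0.le (flow E u x) = 1 := by
  have hcont : Continuous fun u => averagedNorm E hT0.le (flow E u x) :=
    (continuous_averagedNorm hT0.le).comp (continuous_flow.clm_apply continuous_const)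
  have h0 : Tendsto (fun k : ℕ => ((1 : ℝ) / 2) ^ k) atTop (𝓝 0) :=
    tendsto_pow_atTop_nhds_zero_of_lt_one (by norm_num) (by norm_num)
  have hpos := averagedNorm_pos (E := E) hT0 hx
  obtain ⟨k, hk⟩ : ∃ k : ℕ, (1 / 2 : ℝ) ^ k * averagedNorm E hT0.le x < 1 := by
    have := h0.mul_const (averagedNorm E hT0.le x)
    rw [zero_mul] at this
    exact (this.eventually_lt_const zero_lt_one).exists
  obtain ⟨l, hl⟩ : ∃ l : ℕ, (1 / 2 : ℝ) ^ l < averagedNorm E hT0.le x :=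
    (h0.eventually_lt_const hpos).exists
  have h1 := averagedNorm_flow_neg_nat_le hT0 hT k x
  have h2 := averagedNorm_flow_neg_nat_le hT0 hT l (flow E (l * T) x)
  rw [flow_neg_apply_flow] at h2
  have h3 : 1 ≤ averagedNorm E hT0.le (flow E (l * T) x) := by
    have : 0 < ((1 : ℝ) / 2) ^ l := by positivity
    by_contra! h
    nlinarith
  obtain ⟨u, hu⟩ := mem_range_of_exists_le_of_exists_ge hcont ⟨_, (h1.trans_lt hk).le⟩ ⟨_, h3⟩
  exact ⟨u, hu⟩

/-- The averaged norm gives polar coordinates for `E`. -/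
lemma isPolarNorm_averagedNorm {T : ℝ} (hT0 : 0 < T) (hT : ‖flow E (-T)‖ ≤ 1 / 2) :
    IsPolarNorm E (averagedNorm E hT0.le) := by
  set ν := averagedNorm E hT0.le with hν
  have hcν : Continuous ν := continuous_averagedNorm hT0.le
  choose! u hu using fun (x : Space N) (hx : x ≠ 0) => exists_averagedNorm_flow_eq_one hT0 hT hx
  have hmono := fun {x : Space N} (hx : x ≠ 0) => strictMono_averagedNorm_flow hT0 hT hx
  have hne : ∀ θ : Space N, ν θ = 1 → θ ≠ 0 := by
    rintro θ h rfl
    simp at h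
  have hflow_ne : ∀ p, polarMap E ν p ≠ 0 := fun p => flow_ne_zero (hne _ p.2.2) _
  -- Along each orbit the norm is strictly increasing, so `a < u x` and `u x < a` are strict
  -- inequalities between `ν (flow E a x)` and `1`, hence open conditions on `x`.
  have hu_cont : Continuous fun x : {x : Space N // x ≠ 0} => u x := by
    rw [continuous_iff_continuousAt]
    intro x
    have hev : ∀ a, Continuous fun y : {x : Space N // x ≠ 0} => ν (flow E a y) := fun a =>
      hcν.comp ((flow E a).continuous.comp continuous_subtype_val)
    refine tendsto_order.mpr ⟨fun a ha => ?_, fun a ha => ?_⟩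
    · have h1 : ν (flow E a x) < 1 := by
        rw [← hu x x.2]; exact hmono x.2 ha
      filter_upwards [(hev a).continuousAt.eventually_lt_const h1] with y hy
      rw [← hu y y.2] at hy
      exact (hmono y.2).lt_iff_lt.mp hy
    · have h1 : 1 < ν (flow E a x) := by
        rw [← hu x x.2]; exact hmono x.2 ha
      filter_upwards [(hev a).continuousAt.eventually_const_lt h1] with y hy
      rw [← hu y y.2] at hy
      exact (hmono y.2).lt_iff_lt.mp hy
  refine ⟨fun x hx => ?_, ?_, ?_⟩
  · by_contra h
    exact (averagedNorm_pos hT0 h).ne' hx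
  · let g : {x : Space N // x ≠ 0} → Set.Ioi (0 : ℝ) × {θ : Space N // ν θ = 1} := fun x =>
      (⟨Real.exp (-u x), Real.exp_pos _⟩, ⟨flow E (u x) x, hu x x.2⟩)
    let f : Set.Ioi (0 : ℝ) × {θ : Space N // ν θ = 1} → {x : Space N // x ≠ 0} := fun p =>
      ⟨polarMap E ν p, hflow_ne p⟩
    have hg : Continuous g :=
      (Continuous.subtype_mk (Real.continuous_exp.comp hu_cont.neg) _).prodMk
        (Continuous.subtype_mk (continuous_flow_apply.comp
          (hu_cont.prodMk continuous_subtype_val)) _)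
    have hf : Continuous f := by
      refine Continuous.subtype_mk (continuous_flow_apply.comp (Continuous.prodMk ?_ ?_)) _
      · exact Continuous.log (continuous_subtype_val.comp continuous_fst) fun p => p.1.2.ne'
      · exact continuous_subtype_val.comp continuous_snd
    have hleft : Function.LeftInverse g f := by
      rintro ⟨⟨r, hr⟩, ⟨θ, hθ⟩⟩
      have hr' : 0 < r := hr
      have h1 : u (flow E (Real.log r) θ) = -Real.log r := by
        apply (hmono (flow_ne_zero (hne θ hθ) (Real.log r))).injective
        show ν _ = ν _
        rw [hu _ (flow_ne_zero (hne θ hθ) _), flow_neg_apply_flow, hθ]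
      refine Prod.ext (Subtype.ext ?_) (Subtype.ext ?_)
      · show Real.exp (-u (flow E (Real.log r) θ)) = r
        rw [h1, neg_neg, Real.exp_log hr']
      · show flow E (u (flow E (Real.log r) θ)) (flow E (Real.log r) θ) = θ
        rw [h1, flow_neg_apply_flow]
    exact IsEmbedding.subtypeVal.comp (hleft.isEmbedding hg hf)
  · ext x
    constructor
    · rintro ⟨p, rfl⟩
      exact hflow_ne p
    · intro hx
      refine ⟨(⟨Real.exp (-u x), Real.exp_pos _⟩, ⟨flow E (u x) x, hu x hx⟩), ?_⟩
      show flow E (Real.log (Real.exp (-u x))) (flow E (u x) x) = x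
      rw [Real.log_exp, flow_neg_apply_flow]

end PolarNorm

/-! ### Scale comparison for `τ` and growth of `ψ`. -/

section Growth

variable {N : ℕ} {E : Matrix (Fin N) (Fin N) ℝ}

lemma exists_norm_le_norm_flow (hE : EigenvaluesReGtOne E) (ν : Seminorm ℝ (Space N)) :
    ∃ ε > 0, ∀ θ, ν θ = 1 → ∀ s, 0 ≤ s → ε ≤ ‖flow E s θ‖ := by
  obtain ⟨C, hC0, hC⟩ := hE.exists_norm_flow_neg_le
  obtain ⟨K, hK0, hK⟩ := ν.bound_of_continuous_normedSpace
    (continuous_seminorm ν)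
  refine ⟨1 / (K * C), by positivity, fun θ hθ s hs => ?_⟩
  have h1 : ‖θ‖ ≤ C * ‖flow E s θ‖ := by
    conv_lhs => rw [← flow_neg_apply_flow (E := E) s θ]
    exact ((flow E (-s)).le_opNorm _).trans
      (mul_le_mul_of_nonneg_right (hC s hs) (norm_nonneg _))
  rw [div_le_iff₀ (by positivity)]
  calc 1 = ν θ := hθ.symm
    _ ≤ K * ‖θ‖ := hK θ
    _ ≤ K * (C * ‖flow E s θ‖) := by gcongr
    _ = _ := by ring

lemma tau_eq_zero_or {ν : Seminorm ℝ (Space N)} (x : Space N) :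
    tau E ν x = 0 ∨ (0 < tau E ν x ∧ ∃ θ, ν θ = 1 ∧ flow E (Real.log (tau E ν x)) θ = x) := by
  unfold tau
  split_ifs with h
  · exact Or.inr h.choose_spec
  · exact Or.inl rfl

/-- With `x = τ^E θ`, the vector `r^{-E} x = (τ/r)^E θ` is a unit vector moved forward in time. This
`ε` is the radius for the test function of the spectral bound. -/
lemma exists_le_norm_of_le_tau (hE : EigenvaluesReGtOne E) (ν : Seminorm ℝ (Space N)) :
    ∃ ε > 0, ∀ r > 0, ∀ x, r ≤ tau E ν x → ε ≤ ‖flow E (-Real.log r) x‖ := by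
  obtain ⟨ε, hε, h⟩ := exists_norm_le_norm_flow hE ν
  refine ⟨ε, hε, fun r hr x hx => ?_⟩
  rcases tau_eq_zero_or (E := E) (ν := ν) x with h0 | ⟨h0, θ, hθ, hx'⟩
  · linarith
  · conv_rhs => rw [← hx', ← flow_add_apply]
    refine h θ hθ _ ?_
    have := Real.log_le_log hr hx
    linarith

lemma tau_nonneg {ν : Seminorm ℝ (Space N)} (x : Space N) : 0 ≤ tau E ν x := by
  rcases tau_eq_zero_or (E := E) (ν := ν) x with h | h
  · exact h.ge
  · exact h.1.le

lemma IsSymmHomogeneous.flow {ψ : Space N → ℝ} (hψ : IsSymmHomogeneous E ψ) (s : ℝ) {x : Space N}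
    (hx : x ≠ 0) : ψ (flow E.transpose s x) = Real.exp s * ψ x := by
  have := hψ.homogeneous (Real.exp s) (Real.exp_pos s) x hx
  rwa [powOp_eq_flow, Real.log_exp] at this

/-- A homogeneous function grows at most polynomially. -/
lemma IsSymmHomogeneous.exists_le_pow (hE : EigenvaluesReGtOne E) {ψ : Space N → ℝ}
    (hψ : IsSymmHomogeneous E ψ) : ∃ C > 0, ∃ m : ℕ, ∀ x, ψ x ≤ C * (1 + ‖x‖) ^ m := by
  obtain ⟨T, hT0, hT⟩ := hE.exists_norm_flow_le_half
  obtain ⟨C, hC⟩ := (isCompact_closedBall (0 : Space N) 1).exists_bound_of_continuousOn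
    hψ.continuous.continuousOn
  obtain ⟨m, hm⟩ : ∃ m : ℕ, Real.exp T ≤ 2 ^ m :=
    pow_unbounded_of_one_lt _ one_lt_two |>.imp fun _ h => h.le
  refine ⟨max C 1 * 2 ^ m, by positivity, m, fun x => ?_⟩
  -- With `2^k ≤ 1 + ‖x‖ < 2^(k+1)`, running the transposed flow back for `k + 1` periods brings `x`
  -- into the unit ball; each period costs `ψ` a factor `e^T ≤ 2^m`.
  obtain ⟨k, hk1, hk2⟩ := exists_nat_pow_near (x := 1 + ‖x‖) (y := 2) (by simp) one_lt_two
  rcases eq_or_ne x 0 with rfl | hx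
  · have h1 := hC 0 (by simp)
    have h2 : (1 : ℝ) ≤ 2 ^ m := one_le_pow₀ one_le_two
    simp only [norm_zero, add_zero, one_pow, mul_one]
    calc ψ 0 ≤ C := (Real.le_norm_self _).trans h1
      _ ≤ max C 1 * 1 := by simp
      _ ≤ _ := by gcongr
  have hsmall : ‖OperatorScaling.flow E.transpose (-((k + 1 : ℕ) * T)) x‖ ≤ 1 := by
    have h1 := norm_flow_nat_mul_le (E := E.transpose) (by rwa [norm_flow_transpose]) (k + 1)
    calc _ ≤ _ := ContinuousLinearMap.le_opNorm _ _
      _ ≤ (1 / 2) ^ (k + 1) * 2 ^ (k + 1) := by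
        gcongr
        linarith
      _ = 1 := by rw [← mul_pow]; norm_num
  have h1 := hC _ (mem_closedBall_zero_iff.mpr hsmall)
  rw [hψ.flow _ hx, Real.norm_eq_abs] at h1
  have h2 : ψ x ≤ max C 1 * Real.exp ((k + 1 : ℕ) * T) := by
    have h3 := (le_abs_self _).trans h1
    rw [Real.exp_neg, inv_mul_le_iff₀ (Real.exp_pos _)] at h3
    calc ψ x ≤ Real.exp ((k + 1 : ℕ) * T) * C := h3
      _ ≤ Real.exp ((k + 1 : ℕ) * T) * max C 1 := by gcongr; simp
      _ = _ := mul_comm _ _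
  calc ψ x ≤ max C 1 * Real.exp ((k + 1 : ℕ) * T) := h2
    _ = max C 1 * Real.exp T ^ (k + 1) := by rw [Real.exp_nat_mul]
    _ ≤ max C 1 * (2 ^ m) ^ (k + 1) := by gcongr
    _ = max C 1 * 2 ^ m * (2 ^ k) ^ m := by ring
    _ ≤ _ := by gcongr

end Growth

/-! ### The lower bound in the spectral domain. -/

section SpectralBound

variable {N : ℕ} {E : Matrix (Fin N) (Fin N) ℝ}

open scoped SchwartzMap FourierTransform ContDiff in
/-- There is a Schwartz function whose (inverse) Fourier transform is supported in a given ball. -/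
lemma exists_schwartzMap_integral_exp_mul {V : Type*} [NormedAddCommGroup V]
    [InnerProductSpace ℝ V] [FiniteDimensional ℝ V] [MeasurableSpace V] [BorelSpace V]
    {ε : ℝ} (hε : 0 < ε) :
    ∃ g : 𝓢(V, ℂ), ∫ ξ, g ξ = 1 ∧ ∀ x : V, ε ≤ ‖x‖ →
      ∫ ξ, Complex.exp (Complex.I * ((inner ℝ x ξ : ℝ) : ℂ)) * g ξ = 0 := by
  -- The radius is divided by `2π` because the Fourier transform uses the character `e^{2πi⟨x,ξ⟩}`,
  -- whereas the kernel uses `e^{i⟨x,ξ⟩}`.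
  let φ : ContDiffBump (0 : V) := ⟨ε / (2 * Real.pi) / 2, ε / (2 * Real.pi), by positivity,
    half_lt_self (by positivity)⟩
  have hφc : HasCompactSupport fun x => (φ x : ℂ) := φ.hasCompactSupport.comp_left Complex.ofReal_zero
  have hφs : ContDiff ℝ ∞ fun x => (φ x : ℂ) := Complex.ofRealCLM.contDiff.comp φ.contDiff
  let δ : 𝓢(V, ℂ) := hφc.toSchwartzMap hφs
  have key : ∀ x : V, ∫ ξ, Complex.exp (Complex.I * ((inner ℝ x ξ : ℝ) : ℂ)) * (𝓕 δ) ξ =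
      φ ((2 * Real.pi)⁻¹ • x) := by
    intro x
    have h1 : (𝓕⁻ (𝓕 δ)) ((2 * Real.pi)⁻¹ • x) = δ ((2 * Real.pi)⁻¹ • x) := by
      rw [FourierTransform.fourierInv_fourier_eq]
    rw [SchwartzMap.fourierInv_coe, Real.fourierInv_eq'] at h1
    change _ = (φ ((2 * Real.pi)⁻¹ • x) : ℂ) at h1
    rw [← h1]
    congr 1
    ext ξ
    rw [smul_eq_mul, real_inner_smul_right, real_inner_comm, mul_inv_cancel_left₀ (by positivity),
      mul_comm Complex.I]
  refine ⟨𝓕 δ, ?_, fun x hx => ?_⟩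
  · have := key 0
    simp only [inner_zero_left, Complex.ofReal_zero, mul_zero, Complex.exp_zero, one_mul,
      smul_zero] at this
    rw [this, φ.one_of_mem_closedBall (Metric.mem_closedBall_self φ.rIn_pos.le), Complex.ofReal_one]
  · rw [key, φ.zero_of_le_dist, Complex.ofReal_zero]
    rw [dist_zero_right, norm_smul, Real.norm_of_nonneg (by positivity)]
    change ε / (2 * Real.pi) ≤ _
    rw [div_eq_inv_mul]
    gcongr

lemma integral_exp_mul_comp_flow (g : Space N → ℂ) (s : ℝ) (x : Space N) :
    ∫ ξ, Complex.exp (Complex.I * ((inner ℝ x ξ : ℝ) : ℂ)) * g (flow E.transpose s ξ) =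
      Real.exp (-(s * E.trace)) •
        ∫ ξ, Complex.exp (Complex.I * ((inner ℝ (flow E (-s) x) ξ : ℝ) : ℂ)) * g ξ := by
  have h := integral_comp_flow (E := E.transpose) s
    (fun ξ => Complex.exp (Complex.I * ((inner ℝ (flow E (-s) x) ξ : ℝ) : ℂ)) * g ξ)
  rw [Matrix.trace_transpose] at h
  rw [← h]
  congr 1
  ext ξ
  rw [← inner_flow, flow_apply_flow_neg]

-- One factor `‖g‖` absorbs the polynomial growth of `ψ^p`, and the other is integrable.
open scoped SchwartzMap in
lemma integrable_rpow_mul_schwartz {ψ : Space N → ℝ} (hψc : Continuous ψ) (hψ0 : ∀ x, 0 ≤ ψ x)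
    {C : ℝ} {m : ℕ} (hC : ∀ x, ψ x ≤ C * (1 + ‖x‖) ^ m) {p : ℝ} (hp : 0 ≤ p) (g : 𝓢(Space N, ℂ)) :
    Integrable fun x => ψ x ^ p * ‖g x‖ ^ 2 := by
  obtain ⟨M, hM⟩ := exists_nat_ge p
  set D := max C 1
  have hψle : ∀ x, ψ x ^ p ≤ D ^ M * (1 + ‖x‖) ^ (m * M) := by
    intro x
    have h1 : (1 : ℝ) ≤ (1 + ‖x‖) ^ m := one_le_pow₀ (by simp)
    have h2 : ψ x ≤ D * (1 + ‖x‖) ^ m := (hC x).trans (by gcongr; exact le_max_left _ _)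
    have h3 : 1 ≤ D * (1 + ‖x‖) ^ m := one_le_mul_of_one_le_of_one_le (le_max_right _ _) h1
    calc ψ x ^ p ≤ (D * (1 + ‖x‖) ^ m) ^ p := Real.rpow_le_rpow (hψ0 x) h2 hp
      _ ≤ (D * (1 + ‖x‖) ^ m) ^ (M : ℝ) := Real.rpow_le_rpow_of_exponent_le h3 hM
      _ = _ := by rw [Real.rpow_natCast, mul_pow, pow_mul]
  set S := 2 ^ (m * M) * (Finset.Iic (m * M, 0)).sup
    (fun m => SchwartzMap.seminorm ℝ m.1 m.2) g
  have hS : ∀ x, (1 + ‖x‖) ^ (m * M) * ‖g x‖ ≤ S := fun x => by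
    simpa using SchwartzMap.one_add_le_sup_seminorm_apply (𝕜 := ℝ) (m := (m * M, 0))
      (k := m * M) (n := 0) le_rfl le_rfl g x
  refine Integrable.mono' (g := fun x => D ^ M * S * ‖g x‖) (g.integrable.norm.const_mul _) ?_
    (Eventually.of_forall fun x => ?_)
  · exact ((hψc.rpow_const fun _ => Or.inr hp).mul (g.continuous.norm.pow 2)).aestronglyMeasurable
  · rw [Real.norm_of_nonneg (mul_nonneg (Real.rpow_nonneg (hψ0 x) _) (by positivity))]
    calc ψ x ^ p * ‖g x‖ ^ 2 ≤ D ^ M * (1 + ‖x‖) ^ (m * M) * ‖g x‖ ^ 2 := by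
          gcongr; exact hψle x
      _ = D ^ M * ((1 + ‖x‖) ^ (m * M) * ‖g x‖) * ‖g x‖ := by ring
      _ ≤ _ := by gcongr; exact hS x

lemma sq_norm_integral_mul_le {α : Type*} [MeasurableSpace α] {μ : Measure α} {f g : α → ℂ}
    (hf : MemLp f 2 μ) (hg : MemLp g 2 μ) :
    ‖∫ x, f x * g x ∂μ‖ ^ 2 ≤ (∫ x, ‖f x‖ ^ 2 ∂μ) * ∫ x, ‖g x‖ ^ 2 ∂μ := by
  have h := integral_mul_norm_le_Lp_mul_Lq (p := 2) (q := 2) (μ := μ) (f := f) (g := g)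
    Real.HolderConjugate.two_two (by simpa using hf) (by simpa using hg)
  simp only [Real.rpow_ofNat, ← Real.sqrt_eq_rpow] at h
  have h2 : ‖∫ x, f x * g x ∂μ‖ ≤ ∫ x, ‖f x‖ * ‖g x‖ ∂μ := by
    simpa only [norm_mul] using norm_integral_le_integral_norm (fun x => f x * g x) (μ := μ)
  calc ‖∫ x, f x * g x ∂μ‖ ^ 2 ≤ (√(∫ x, ‖f x‖ ^ 2 ∂μ) * √(∫ x, ‖g x‖ ^ 2 ∂μ)) ^ 2 := by
        gcongr; exact h2.trans h
    _ = _ := by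
      rw [mul_pow, Real.sq_sqrt (by positivity), Real.sq_sqrt (by positivity)]

/-- The spectral form of strong local nondeterminism: `e^{i⟨y, ξ⟩}` stays away in
`L²(ψ^{-2-Q})` from the exponentials with frequencies at distance at least `r` from `y`. -/
lemma exists_mul_sq_le_integral_kernel [Nontrivial (Space N)] (hE : EigenvaluesReGtOne E)
    {ψ : Space N → ℝ} (hψ : IsSymmHomogeneous E ψ) (htr : 0 ≤ E.trace) {ε : ℝ} (hε : 0 < ε) :
    ∃ C > 0, ∀ {ι : Type} (I : Finset ι) (b : ι → ℂ) (x : ι → Space N) (y : Space N) (s : ℝ),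
      ε ≤ ‖flow E (-s) y‖ → (∀ i ∈ I, ε ≤ ‖flow E (-s) (y - x i)‖) →
      MemLp (fun ξ => harmonizableKernel E ψ y ξ - ∑ i ∈ I, b i * harmonizableKernel E ψ (x i) ξ) 2 →
      C * Real.exp s ^ 2 ≤
        ∫ ξ, ‖harmonizableKernel E ψ y ξ - ∑ i ∈ I, b i * harmonizableKernel E ψ (x i) ξ‖ ^ 2 := by
  obtain ⟨g, hg1, hg0⟩ := exists_schwartzMap_integral_exp_mul (V := Space N) hε
  obtain ⟨C, -, m, hC⟩ := hψ.exists_le_pow hE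
  set p := 1 + E.trace / 2 with hp
  have hp0 : 0 < p := by positivity
  set K := ∫ ξ, ψ ξ ^ (2 * p) * ‖g ξ‖ ^ 2 with hK
  have hk := integrable_rpow_mul_schwartz hψ.continuous hψ.nonneg hC (p := 2 * p) (by positivity) g
  have hK0 : 0 ≤ K := integral_nonneg fun ξ =>
    mul_nonneg (Real.rpow_nonneg (hψ.nonneg ξ) _) (by positivity)
  -- Adding `1` makes the constant meaningful without proving `K > 0`.
  refine ⟨1 / (K + 1), by positivity, fun {ι} I b x y s hy hx hG => ?_⟩
  set G := fun ξ => harmonizableKernel E ψ y ξ -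
    ∑ i ∈ I, b i * harmonizableKernel E ψ (x i) ξ with hGdef
  let e : Space N → Space N → ℂ := fun x ξ => Complex.exp (Complex.I * ((inner ℝ x ξ : ℝ) : ℂ))
  have he_add : ∀ x y ξ, e x ξ * e y ξ = e (x + y) ξ := fun x y ξ => by
    simp only [e]
    rw [← Complex.exp_add, inner_add_left, Complex.ofReal_add, mul_add]
  have he_zero : ∀ ξ, e 0 ξ = 1 := fun ξ => by simp [e]
  have he_norm : ∀ x ξ, ‖e x ξ‖ = 1 := fun x ξ => by
    simp only [e]; rw [mul_comm, Complex.norm_exp_ofReal_mul_I]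
  have he_cont : ∀ x, Continuous (e x) := fun x => by fun_prop
  let gs : Space N → ℂ := fun ξ => g (flow E.transpose s ξ)
  have hgs : Integrable gs := integrable_comp_flow s g.integrable
  have hgs_cont : Continuous gs := g.continuous.comp (flow _ s).continuous
  have hegs : ∀ x, Integrable fun ξ => e x ξ * gs ξ := fun x =>
    hgs.bdd_mul (c := 1) (he_cont x).aestronglyMeasurable
      (Eventually.of_forall fun ξ => (he_norm x ξ).le)
  -- The dual test function: the weight undoes the denominator of the kernels, the exponential
  -- recenters frequencies at `y`, and `gs` localizes at scale `e^s`.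
  let H : Space N → ℂ := fun ξ => ((ψ ξ ^ p : ℝ) : ℂ) * (e (-y) ξ * gs ξ)
  have hHcont : Continuous H := (Complex.continuous_ofReal.comp
    (hψ.continuous.rpow_const fun _ => Or.inr hp0.le)).mul ((he_cont _).mul hgs_cont)
  have hne : ∀ᵐ ξ : Space N, ξ ≠ 0 := by simp [ae_iff]
  have hHsq : (fun ξ => ‖H ξ‖ ^ 2) =ᵐ[volume] fun ξ => Real.exp (-(s * (2 * p))) *
      (ψ (flow E.transpose s ξ) ^ (2 * p) * ‖g (flow E.transpose s ξ)‖ ^ 2) := by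
    filter_upwards [hne] with ξ hξ
    have h0 := hψ.nonneg ξ
    rw [hψ.flow s hξ, Real.mul_rpow (Real.exp_pos s).le h0, ← Real.exp_mul, mul_assoc,
      ← mul_assoc, ← Real.exp_add, neg_add_cancel, Real.exp_zero, one_mul, norm_mul, norm_mul,
      he_norm, one_mul, mul_pow, Complex.norm_real, Real.norm_of_nonneg (Real.rpow_nonneg h0 _),
      ← Real.rpow_natCast (ψ ξ ^ p), ← Real.rpow_mul h0, Nat.cast_ofNat, mul_comm p]
  have hHint : ∫ ξ, ‖H ξ‖ ^ 2 = Real.exp (-(s * (2 * p))) * (Real.exp (-(s * E.trace)) * K) := by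
    rw [integral_congr_ae hHsq, integral_const_mul, hK]
    have := integral_comp_flow (E := E.transpose) s (fun ξ => ψ ξ ^ (2 * p) * ‖g ξ‖ ^ 2)
    rw [Matrix.trace_transpose, smul_eq_mul] at this
    rw [this]
  have hH : MemLp H 2 := by
    rw [memLp_two_iff_integrable_sq_norm hHcont.aestronglyMeasurable]
    exact ((integrable_comp_flow s hk).const_mul _).congr hHsq.symm
  have hGH : (fun ξ => G ξ * H ξ) =ᵐ[volume] fun ξ => (e 0 ξ * gs ξ - e (-y) ξ * gs ξ) -
      ∑ i ∈ I, b i * (e (x i - y) ξ * gs ξ - e (-y) ξ * gs ξ) := by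
    filter_upwards [hne] with ξ hξ
    have hψξ : ((ψ ξ ^ p : ℝ) : ℂ) ≠ 0 := by
      exact_mod_cast (Real.rpow_pos_of_pos (hψ.pos ξ hξ) p).ne'
    have hker : ∀ z, harmonizableKernel E ψ z ξ * H ξ = e (z - y) ξ * gs ξ - e (-y) ξ * gs ξ := by
      intro z
      change (e z ξ - 1) / ((ψ ξ ^ p : ℝ) : ℂ) * (((ψ ξ ^ p : ℝ) : ℂ) * (e (-y) ξ * gs ξ)) = _
      rw [sub_eq_add_neg z, ← he_add]
      field_simp
    simp only [hGdef, sub_mul, Finset.sum_mul, mul_assoc, hker, sub_self]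
  have hJ : ∀ z, ∫ ξ, e z ξ * gs ξ = Real.exp (-(s * E.trace)) • ∫ ξ, e (flow E (-s) z) ξ * g ξ :=
    fun z => integral_exp_mul_comp_flow g s z
  have hJ0 : ∀ z, ε ≤ ‖flow E (-s) z‖ → ∫ ξ, e (-z) ξ * gs ξ = 0 := fun z hz => by
    rw [hJ, hg0 _ (by rwa [map_neg, norm_neg]), smul_zero]
  -- Only the zero frequency `y - y` survives, so the value does not depend on the coefficients `b`.
  have hGHint : ∫ ξ, G ξ * H ξ = Real.exp (-(s * E.trace)) := by
    have hD : ∀ w z, Integrable fun ξ => e w ξ * gs ξ - e z ξ * gs ξ := fun w z =>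
      (hegs w).sub (hegs z)
    rw [integral_congr_ae hGH, integral_sub (hD _ _)
      (integrable_finsetSum _ fun i _ => (hD _ _).const_mul _),
      integral_sub (hegs _) (hegs _), integral_finsetSum _
      fun i _ => (hD _ _).const_mul _, hJ0 y hy, Finset.sum_eq_zero, hJ, map_zero]
    · simp only [he_zero, one_mul, hg1]
      simp
    · intro i hi
      rw [integral_const_mul, integral_sub (hegs _) (hegs _), hJ0 y hy, ← neg_sub y (x i), hJ0 _ (hx i hi)]
      simp
  have hCS := sq_norm_integral_mul_le hG hH
  rw [hGHint, hHint, Complex.norm_real, Real.norm_of_nonneg (Real.exp_pos _).le] at hCS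
  set A := ∫ ξ, ‖G ξ‖ ^ 2 with hA
  have hA0 : 0 ≤ A := by positivity
  -- Since `2p = 2 + Q`, the powers of `e^{-sQ}` on the two sides of Cauchy–Schwarz cancel and leave
  -- exactly `e^{2s}`.
  have hexp : Real.exp (-(s * (2 * p))) = Real.exp (-(s * E.trace)) * (Real.exp s ^ 2)⁻¹ := by
    rw [← Real.exp_nat_mul, ← Real.exp_neg, ← Real.exp_add]
    congr 1
    rw [hp]; push_cast; ring
  rw [hexp] at hCS
  have hq := Real.exp_pos (-(s * E.trace))
  have hr : 0 < Real.exp s ^ 2 := by positivity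
  have h1 : Real.exp s ^ 2 ≤ A * K := by
    have : Real.exp (-(s * E.trace)) ^ 2 * 1 ≤
        Real.exp (-(s * E.trace)) ^ 2 * (A * K * (Real.exp s ^ 2)⁻¹) := by
      linarith
    have := le_of_mul_le_mul_left this (by positivity)
    rwa [← div_eq_mul_inv, le_div_iff₀ hr, one_mul] at this
  rw [one_div_mul_eq_div, div_le_iff₀ (by positivity)]
  linarith

end SpectralBound

/-! ### Closedness of centered Gaussian laws in `L²`. -/

section GaussianLimit

variable {Ω : Type*} [MeasurableSpace Ω] {P : Measure Ω}

/-- Limits in `L²` of centered Gaussian variables are centered Gaussian. -/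
lemma map_eq_gaussianReal_of_tendsto_Lp [IsProbabilityMeasure P] {u : ℕ → Lp ℝ 2 P} {w : Lp ℝ 2 P}
    (hu : Tendsto u atTop (𝓝 w))
    (h : ∀ n, P.map (u n) = gaussianReal 0 (‖u n‖₊ ^ 2)) :
    P.map w = gaussianReal 0 (‖w‖₊ ^ 2) := by
  have hm : ∀ v : Lp ℝ 2 P, AEMeasurable v P := fun v => (Lp.aestronglyMeasurable v).aemeasurable
  have : IsProbabilityMeasure (P.map w) := Measure.isProbabilityMeasure_map (hm w)
  refine Measure.ext_of_charFun (funext fun t => ?_)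
  have hchar : ∀ v : Lp ℝ 2 P, charFun (P.map v) t = ∫ ω, Complex.exp (t * v ω * Complex.I) ∂P := by
    intro v
    rw [charFun_apply_real, integral_map (hm v) (by fun_prop)]
  -- Almost sure convergence along a subsequence suffices: it identifies the limit of the
  -- characteristic functions by dominated convergence.
  obtain ⟨ns, hns, hae⟩ := (tendstoInMeasure_of_tendsto_Lp hu).exists_seq_tendsto_ae
  have h1 : Tendsto (fun k => charFun (P.map (u (ns k))) t) atTop (𝓝 (charFun (P.map w) t)) := by
    simp only [hchar]
    refine tendsto_integral_of_dominated_convergence (fun _ => (1 : ℝ)) (fun k => ?_)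
      (integrable_const _) (fun k => Eventually.of_forall fun ω => ?_) ?_
    · exact (Continuous.comp_aestronglyMeasurable
        (g := fun x : ℝ => Complex.exp (t * x * Complex.I)) (by fun_prop)
        (Lp.aestronglyMeasurable (u (ns k))))
    · rw [← Complex.ofReal_mul, Complex.norm_exp_ofReal_mul_I]
    · filter_upwards [hae] with ω hω
      have hc : Continuous fun x : ℝ => Complex.exp (t * x * Complex.I) := by fun_prop
      exact (hc.tendsto _).comp hω
  have h2 : Tendsto (fun k => charFun (P.map (u (ns k))) t) atTop
      (𝓝 (charFun (gaussianReal 0 (‖w‖₊ ^ 2)) t)) := by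
    simp only [h, charFun_gaussianReal, NNReal.coe_pow, coe_nnnorm]
    have hn : Tendsto (fun k => ‖u (ns k)‖) atTop (𝓝 ‖w‖) :=
      (hu.comp hns.tendsto_atTop).norm
    have hc : Continuous fun x : ℝ =>
        Complex.exp (t * (0 : ℝ) * Complex.I - ((x ^ 2 : ℝ) : ℂ) * t ^ 2 / 2) := by fun_prop
    exact (hc.tendsto _).comp hn
  exact tendsto_nhds_unique h1 h2

lemma integral_sq_coeFn_Lp (u : Lp ℝ 2 P) : ∫ ω, u ω ^ 2 ∂P = ‖u‖ ^ 2 := by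
  rw [← real_inner_self_eq_norm_sq, L2.inner_def]
  simp [pow_two]

lemma map_eq_gaussianReal_iff [IsProbabilityMeasure P] (u : Lp ℝ 2 P) :
    P.map u = gaussianReal 0 (‖u‖₊ ^ 2) ↔ HasGaussianLaw u P ∧ ∫ ω, u ω ∂P = 0 := by
  have hm : AEMeasurable u P := (Lp.aestronglyMeasurable u).aemeasurable
  constructor
  · intro h
    have hg : HasGaussianLaw u P := ⟨by rw [h]; infer_instance⟩
    refine ⟨hg, ?_⟩
    have h1 : ∫ x, x ∂(P.map u) = 0 := by rw [h, integral_id_gaussianReal]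
    rwa [integral_map hm (by fun_prop)] at h1
  · rintro ⟨hg, h0⟩
    rw [hg.map_eq_gaussianReal, h0]
    congr 1
    rw [variance_of_integral_eq_zero hm h0]
    refine NNReal.eq ?_
    rw [Real.coe_toNNReal _ (by positivity), NNReal.coe_pow, coe_nnnorm]
    exact integral_sq_coeFn_Lp u

end GaussianLimit

/-! ### Conditional variance as a residual second moment. -/

section ConditionalVariance

variable {Ω : Type*} {mΩ : MeasurableSpace Ω} {P : Measure Ω}

/-- These are coefficients of the orthogonal projection onto the span; the `w k` may be linearly
dependent, as happens when points repeat. -/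
lemma exists_sub_sum_orthogonal {H : Type*} [NormedAddCommGroup H] [InnerProductSpace ℝ H]
    {κ : Type*} [Fintype κ] (x : H) (w : κ → H) :
    ∃ a : κ → ℝ, ∀ k, inner ℝ (w k) (x - ∑ j, a j • w j) = 0 := by
  set K := Submodule.span ℝ (Set.range w) with hK
  have : FiniteDimensional ℝ K := FiniteDimensional.span_of_finite ℝ (Set.finite_range w)
  obtain ⟨a, ha⟩ := (Submodule.mem_span_range_iff_exists_fun ℝ).mp
    (K.starProjection_apply_mem x)
  refine ⟨a, fun k => ?_⟩
  rw [ha]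
  exact K.sub_starProjection_mem_orthogonal x _ (Submodule.subset_span ⟨k, rfl⟩)

/-- For a centered Gaussian process, the conditional variance given finitely many values is the
second moment of the residual. -/
lemma condVar_ae_eq_of_isGaussianProcess [IsProbabilityMeasure P] {T κ : Type*} [Fintype κ]
    {X : T → Ω → ℝ} (hX : IsGaussianProcess X P) (hmeas : ∀ t, Measurable (X t))
    (hcent : ∀ t, ∫ ω, X t ω ∂P = 0) (τ : κ → T) (t : T) (a : κ → ℝ)
    (horth : ∀ k, ∫ ω, X (τ k) ω * (X t ω - ∑ j, a j * X (τ j) ω) ∂P = 0) :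
    Var[X t; P | MeasurableSpace.comap (fun ω k => X (τ k) ω) inferInstance] =ᵐ[P]
      fun _ => ∫ ω, (X t ω - ∑ j, a j * X (τ j) ω) ^ 2 ∂P := by
  classical
  set Z : Ω → ℝ := fun ω => X t ω - ∑ j, a j * X (τ j) ω with hZ
  have hmem : ∀ t, MemLp (X t) 2 P := fun t => (hX.hasGaussianLaw_eval t).memLp_two
  have hZmeas : Measurable Z :=
    (hmeas t).sub (Finset.measurable_sum _ fun j _ => (hmeas _).const_mul _)
  have hWmeas : Measurable fun ω k => X (τ k) ω := measurable_pi_lambda _ fun k => hmeas _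
  have hint : ∀ t, Integrable (X t) P := fun t => (hmem t).integrable one_le_two
  have hS2 : MemLp (fun ω => ∑ j, a j * X (τ j) ω) 2 P :=
    memLp_finsetSum _ fun j _ => (hmem _).const_mul _
  have hZ2 : MemLp Z 2 P := (hmem t).sub hS2
  have hZint : Integrable Z P := hZ2.integrable one_le_two
  have hZ0 : ∫ ω, Z ω ∂P = 0 := by
    rw [hZ, integral_sub (hint t) (hS2.integrable one_le_two),
      integral_finsetSum _ fun j _ => (hint _).const_mul _, hcent]
    simp [integral_const_mul, hcent]
  let J : Finset T := insert t (Finset.univ.image τ)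
  have hpair : IsGaussianProcess (Sum.elim (fun k => X (τ k)) fun _ : Unit => Z) P := by
    refine hX.of_isGaussianProcess fun s => ⟨J, ?_⟩
    have hmemJ : ∀ k, τ k ∈ J := fun k =>
      Finset.mem_insert_of_mem (Finset.mem_image_of_mem τ (Finset.mem_univ k))
    let pr : ∀ s ∈ J, (J → ℝ) →L[ℝ] ℝ := fun s hs => ContinuousLinearMap.proj ⟨s, hs⟩
    cases s with
    | inl k => exact ⟨pr (τ k) (hmemJ k), fun ω => rfl⟩
    | inr _ =>
      refine ⟨pr t (Finset.mem_insert_self _ _) - ∑ j, a j • pr (τ j) (hmemJ j), fun ω => ?_⟩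
      simp [hZ, pr]
  -- The past and the residual are jointly Gaussian and uncorrelated, hence independent.
  have hindep : IndepFun (fun ω k => X (τ k) ω) (fun ω (_ : Unit) => Z ω) P := by
    refine hpair.indepFun_of_covariance_eq_zero (fun k => (hmeas _).aemeasurable)
      (fun _ => hZmeas.aemeasurable) fun k _ => ?_
    rw [covariance_eq_sub (hmem _) hZ2, hcent, zero_mul, sub_zero]
    exact horth k
  have hindep2 : IndepFun Z (fun ω k => X (τ k) ω) P :=
    (hindep.comp (φ := id) (ψ := fun f : Unit → ℝ => f ()) measurable_id
      (measurable_pi_apply ())).symm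
  set m : MeasurableSpace Ω := MeasurableSpace.comap (fun ω k => X (τ k) ω) inferInstance with hm
  have hle : m ≤ mΩ := hWmeas.comap_le
  have hfun : ∀ φ : ℝ → ℝ, Measurable φ →
      P[fun ω => φ (Z ω) | m] =ᵐ[P] fun _ => ∫ ω, φ (Z ω) ∂P := by
    intro φ hφ
    refine condExp_indep_eq (m₁ := MeasurableSpace.comap Z inferInstance) hZmeas.comap_le hle ?_
      ((IndepFun_iff_Indep _ _ _).mp hindep2)
    exact (hφ.comp (comap_measurable Z)).stronglyMeasurable
  have hSmeas : StronglyMeasurable[m] fun ω => ∑ j, a j * X (τ j) ω := by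
    have h1 : Measurable[m] fun ω k => X (τ k) ω := comap_measurable _
    have h2 : Measurable fun w : κ → ℝ => ∑ j, a j * w j := by fun_prop
    exact (h2.comp h1).stronglyMeasurable
  have hcond : P[X t | m] =ᵐ[P] fun ω => ∑ j, a j * X (τ j) ω := by
    have hdecomp : X t = (fun ω => ∑ j, a j * X (τ j) ω) + Z := by ext ω; simp [hZ]
    have h1 := condExp_add (hS2.integrable one_le_two) hZint m
    rw [← hdecomp, condExp_of_stronglyMeasurable hle hSmeas (hS2.integrable one_le_two)] at h1
    filter_upwards [h1, hfun id measurable_id] with ω h1 h2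
    simp only [id] at h2
    rw [h1, Pi.add_apply, h2, hZ0, add_zero]
  have hres : (X t - P[X t | m]) ^ 2 =ᵐ[P] fun ω => Z ω ^ 2 := by
    filter_upwards [hcond] with ω hω
    simp [hZ, hω]
  exact (condExp_congr_ae hres).trans (hfun (fun x => x ^ 2) (by fun_prop))

end ConditionalVariance

/-! ### Integrals of simple functions. -/

section SimpleIntegral

variable {N : ℕ}

/-- The part of the level set `{s = c}` on which `s` does not vanish. -/
def levelSet (s : SimpleFunc (Space N) ℂ) (hs : s.FinMeasSupp volume) (c : ℂ) :
    FiniteMeasureSet N :=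
  ⟨s ⁻¹' {c} ∩ Function.support s,
    (s.measurableSet_fiber c).inter s.measurableSet_support,
    (measure_mono Set.inter_subset_right).trans_lt (SimpleFunc.finMeasSupp_iff_support.mp hs)⟩

lemma levelSet_of_ne_zero (s : SimpleFunc (Space N) ℂ) (hs : s.FinMeasSupp volume) {c : ℂ}
    (hc : c ≠ 0) : (levelSet s hs c).1 = s ⁻¹' {c} :=
  Set.inter_eq_left.mpr fun x hx => by
    rw [Set.mem_preimage, Set.mem_singleton_iff] at hx
    rwa [Function.mem_support, hx]

/-- The zero level set may have infinite measure, where nothing is known about `M`; its coefficient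
is `0`, so it can be replaced by the empty set. -/
lemma simpleIntegral_eq {Ω : Type*} (M : Set (Space N) → Ω → ℂ) (s : SimpleFunc (Space N) ℂ)
    (hs : s.FinMeasSupp volume) (ω : Ω) :
    simpleIntegral M s ω = ∑ c ∈ s.range, c * M (levelSet s hs c).1 ω := by
  refine Finset.sum_congr rfl fun c _ => ?_
  rcases eq_or_ne c 0 with rfl | hc
  · simp
  · rw [levelSet_of_ne_zero s hs hc]

lemma simpleFunc_eq_sum_levelSet (s : SimpleFunc (Space N) ℂ) (hs : s.FinMeasSupp volume)
    (x : Space N) : s x = ∑ c ∈ s.range, c * (levelSet s hs c).1.indicator 1 x := by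
  rw [Finset.sum_eq_single (s x)]
  · rcases eq_or_ne (s x) 0 with h | h
    · simp [h]
    · rw [levelSet_of_ne_zero s hs h, Set.indicator_of_mem (by simp), Pi.one_apply, mul_one]
  · intro c _ hc
    rw [Set.indicator_of_notMem, mul_zero]
    exact fun hx => hc hx.1.symm
  · intro h
    exact absurd (SimpleFunc.mem_range_self s x) h

lemma integral_simpleFunc_mul_conj (s s' : SimpleFunc (Space N) ℂ) (hs : s.FinMeasSupp volume)
    (hs' : s'.FinMeasSupp volume) :
    ∫ x, s x * conj (s' x) = ∑ c ∈ s.range, ∑ d ∈ s'.range,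
      c * conj d * (volume ((levelSet s hs c).1 ∩ (levelSet s' hs' d).1)).toReal := by
  have hmeas : ∀ c d, MeasurableSet ((levelSet s hs c).1 ∩ (levelSet s' hs' d).1) := fun c d =>
    (levelSet s hs c).2.1.inter (levelSet s' hs' d).2.1
  have hfin : ∀ c d, volume ((levelSet s hs c).1 ∩ (levelSet s' hs' d).1) ≠ ∞ := fun c d =>
    ((measure_mono Set.inter_subset_left).trans_lt (levelSet s hs c).2.2).ne
  have hint : ∀ c d : ℂ, Integrable fun x => c * conj d *
      ((levelSet s hs c).1 ∩ (levelSet s' hs' d).1).indicator (fun _ => (1 : ℂ)) x := fun c d =>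
    (((integrable_indicator_iff (hmeas c d)).mpr (integrableOn_const (hfin c d)))).const_mul _
  have hpt : ∀ x, s x * conj (s' x) = ∑ c ∈ s.range, ∑ d ∈ s'.range, c * conj d *
      ((levelSet s hs c).1 ∩ (levelSet s' hs' d).1).indicator (fun _ => (1 : ℂ)) x := by
    intro x
    rw [simpleFunc_eq_sum_levelSet s hs x, simpleFunc_eq_sum_levelSet s' hs' x, map_sum,
      Finset.sum_mul_sum]
    refine Finset.sum_congr rfl fun c _ => Finset.sum_congr rfl fun d _ => ?_
    by_cases h1 : x ∈ (levelSet s hs c).1 <;> by_cases h2 : x ∈ (levelSet s' hs' d).1 <;>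
      simp [h1, h2, Set.indicator]
  simp_rw [hpt]
  rw [integral_finsetSum _ fun c _ => integrable_finsetSum _ fun d _ => hint c d]
  refine Finset.sum_congr rfl fun c _ => ?_
  rw [integral_finsetSum _ fun d _ => hint c d]
  refine Finset.sum_congr rfl fun d _ => ?_
  rw [integral_const_mul, integral_indicator (hmeas c d), setIntegral_const]
  simp [Measure.real]

/-- The simple function `ξ ↦ conj (s (-ξ))`. -/
noncomputable def reflect (s : SimpleFunc (Space N) ℂ) : SimpleFunc (Space N) ℂ :=
  (s.comp (fun x => -x) measurable_neg).map conj

lemma reflect_apply (s : SimpleFunc (Space N) ℂ) (x : Space N) :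
    reflect s x = conj (s (-x)) := rfl

lemma reflect_finMeasSupp {s : SimpleFunc (Space N) ℂ} (hs : s.FinMeasSupp volume) :
    (reflect s).FinMeasSupp volume := by
  rw [SimpleFunc.finMeasSupp_iff_support] at hs ⊢
  have : Function.support (reflect s) = (fun x => -x) ⁻¹' Function.support s := by
    ext x; simp [reflect_apply]
  rw [this]
  change volume (Neg.neg ⁻¹' _) < ∞
  rwa [Measure.measure_preimage_neg]

variable {Ω : Type*} [MeasurableSpace Ω] {P : Measure Ω} {M : Set (Space N) → Ω → ℂ}

lemma IsGaussianRandomMeasure.memLp (hM : IsGaussianRandomMeasure P M) (A : FiniteMeasureSet N) :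
    MemLp (M A.1) 2 P :=
  (hM.gaussian.hasGaussianLaw_eval A).memLp_two

lemma IsGaussianRandomMeasure.memLp_simpleIntegral (hM : IsGaussianRandomMeasure P M)
    {s : SimpleFunc (Space N) ℂ} (hs : s.FinMeasSupp volume) :
    MemLp (simpleIntegral M s) 2 P := by
  rw [funext (simpleIntegral_eq M s hs)]
  exact memLp_finsetSum _ fun c _ => (hM.memLp _).const_mul _

lemma memLp_star {f : Ω → ℂ} (hf : MemLp f 2 P) : MemLp (fun ω => conj (f ω)) 2 P := hf.star

lemma integrable_mul_conj {f g : Ω → ℂ} (hf : MemLp f 2 P) (hg : MemLp g 2 P) :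
    Integrable (fun ω => f ω * conj (g ω)) P := hf.integrable_mul (memLp_star hg)

/-- The isometry property for simple functions. -/
lemma IsGaussianRandomMeasure.integral_simpleIntegral_mul_conj
    (hM : IsGaussianRandomMeasure P M) {s s' : SimpleFunc (Space N) ℂ}
    (hs : s.FinMeasSupp volume) (hs' : s'.FinMeasSupp volume) :
    ∫ ω, simpleIntegral M s ω * conj (simpleIntegral M s' ω) ∂P = ∫ x, s x * conj (s' x) := by
  have hint : ∀ c d : ℂ, Integrable (fun ω => c * conj d *
      (M (levelSet s hs c).1 ω * conj (M (levelSet s' hs' d).1 ω))) P := fun c d =>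
    (integrable_mul_conj (hM.memLp _) (hM.memLp _)).const_mul _
  have hpt : ∀ ω, simpleIntegral M s ω * conj (simpleIntegral M s' ω) =
      ∑ c ∈ s.range, ∑ d ∈ s'.range, c * conj d *
      (M (levelSet s hs c).1 ω * conj (M (levelSet s' hs' d).1 ω)) := by
    intro ω
    rw [simpleIntegral_eq M s hs, simpleIntegral_eq M s' hs', map_sum, Finset.sum_mul_sum]
    refine Finset.sum_congr rfl fun c _ => Finset.sum_congr rfl fun d _ => ?_
    rw [map_mul]; ring
  simp_rw [hpt]
  rw [integral_simpleFunc_mul_conj s s' hs hs',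
    integral_finsetSum _ fun c _ => integrable_finsetSum _ fun d _ => hint c d]
  refine Finset.sum_congr rfl fun c _ => ?_
  rw [integral_finsetSum _ fun d _ => hint c d]
  refine Finset.sum_congr rfl fun d _ => ?_
  rw [integral_const_mul, hM.covariance]

lemma IsGaussianRandomMeasure.simpleIntegral_reflect (hM : IsGaussianRandomMeasure P M)
    {s : SimpleFunc (Space N) ℂ} (hs : s.FinMeasSupp volume) :
    simpleIntegral M (reflect s) =ᵐ[P] fun ω => conj (simpleIntegral M s ω) := by
  have hae : ∀ᵐ ω ∂P, ∀ c ∈ s.range, M ((fun x => -x) ⁻¹' (levelSet s hs c).1) ω =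
      conj (M (levelSet s hs c).1 ω) :=
    (ae_ball_iff s.range.countable_toSet).mpr fun c _ => hM.hermitian _
  filter_upwards [hae] with ω hω
  have hrange : (reflect s).range = s.range.image conj := by
    rw [reflect, SimpleFunc.range_map]
    congr 1
    ext c
    simp only [SimpleFunc.mem_range, SimpleFunc.coe_comp, Set.mem_range, Function.comp_apply]
    exact ⟨fun ⟨x, hx⟩ => ⟨-x, hx⟩, fun ⟨x, hx⟩ => ⟨-x, by rwa [neg_neg]⟩⟩
  rw [simpleIntegral_eq M s hs, simpleIntegral, hrange,
    Finset.sum_image (starRingEnd ℂ).injective.injOn, map_sum]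
  refine Finset.sum_congr rfl fun c hc => ?_
  rw [map_mul, ← hω c hc]
  rcases eq_or_ne c 0 with rfl | hc0
  · simp
  · rw [levelSet_of_ne_zero s hs hc0]
    congr 2
    ext x
    simp only [Set.mem_preimage, Set.mem_singleton_iff, reflect_apply]
    exact (star_injective (R := ℂ)).eq_iff

/-- Real linear combinations of real parts of integrals of simple functions are centered
Gaussian. -/
lemma IsGaussianRandomMeasure.hasGaussianLaw_sum_re (hM : IsGaussianRandomMeasure P M)
    {ι : Type*} [Fintype ι] (s : ι → SimpleFunc (Space N) ℂ)
    (hs : ∀ i, (s i).FinMeasSupp volume) (b : ι → ℝ) :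
    HasGaussianLaw (fun ω => ∑ i, b i * (simpleIntegral M (s i) ω).re) P ∧
      ∫ ω, ∑ i, b i * (simpleIntegral M (s i) ω).re ∂P = 0 := by
  classical
  have hG := (hM.gaussian.comp_right
    (fun p : (Σ _ : ι, ℂ) => levelSet (s p.1) (hs p.1) p.2)).comp_left
    (fun p => b p.1 • (Complex.reCLM ∘L ContinuousLinearMap.mul ℝ ℂ p.2))
  have h := hG.hasGaussianLaw_fun_sum (I := Finset.univ.sigma fun i => (s i).range)
  have heq : (fun ω => ∑ i, b i * (simpleIntegral M (s i) ω).re) = fun ω =>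
      ∑ p ∈ Finset.univ.sigma fun i => (s i).range,
        b p.1 * (p.2 * M (levelSet (s p.1) (hs p.1) p.2).1 ω).re := by
    ext ω
    rw [Finset.sum_sigma]
    refine Finset.sum_congr rfl fun i _ => ?_
    rw [simpleIntegral_eq M (s i) (hs i), Complex.re_sum, Finset.mul_sum]
  rw [heq]
  refine ⟨h, ?_⟩
  have hint : ∀ p : Σ _ : ι, ℂ, Integrable
      (fun ω => p.2 * M (levelSet (s p.1) (hs p.1) p.2).1 ω) P := fun p =>
    ((hM.gaussian.hasGaussianLaw_eval (levelSet (s p.1) (hs p.1) p.2)).integrable).const_mul _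
  have hre : ∀ p : Σ _ : ι, ℂ, Integrable
      (fun ω => b p.1 * (p.2 * M (levelSet (s p.1) (hs p.1) p.2).1 ω).re) P := fun p =>
    (hint p).re.const_mul _
  rw [integral_finsetSum _ fun p _ => hre p]
  refine Finset.sum_eq_zero fun p _ => ?_
  have h1 := integral_re (hint p)
  simp only [RCLike.re_to_complex] at h1
  rw [integral_const_mul, h1, integral_const_mul, hM.centered]
  simp

end SimpleIntegral

/-! ### Isometry, reality and Gaussianity of the Wiener integral. -/

section WienerIntegral

variable {N : ℕ} {Ω : Type*} [MeasurableSpace Ω] {P : Measure Ω} {M : Set (Space N) → Ω → ℂ}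
  {f g : Space N → ℂ} {Y Z : Ω → ℂ}

/-- Being an `L²` limit of simple functions forces square integrability, so that of the kernels near
`0` and at infinity is never estimated directly. -/
lemma IsWienerIntegral.memLp_integrand (hY : IsWienerIntegral P M f Y)
    (hf : AEStronglyMeasurable f) : MemLp f 2 := by
  obtain ⟨-, s, hs, hsf, -⟩ := hY
  obtain ⟨n, hn⟩ := (hsf.eventually_lt_const ENNReal.zero_lt_top).exists
  have h1 : MemLp (s n) 2 volume :=
    (SimpleFunc.memLp_iff_finMeasSupp (by simp) (by simp)).mpr (hs n)
  have h2 : MemLp (fun ξ => s n ξ - f ξ) 2 volume := ⟨h1.1.sub hf, hn⟩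
  convert h1.sub h2 using 1
  ext ξ
  simp

lemma inner_toLp {α : Type*} [MeasurableSpace α] {μ : Measure α} {f g : α → ℂ} (hf : MemLp f 2 μ)
    (hg : MemLp g 2 μ) : inner ℂ (hg.toLp g) (hf.toLp f) = ∫ x, f x * conj (g x) ∂μ := by
  rw [L2.inner_def]
  refine integral_congr_ae ?_
  filter_upwards [hf.coeFn_toLp, hg.coeFn_toLp] with x h1 h2
  rw [h1, h2, RCLike.inner_apply]

/-- The isometry property of the Wiener integral. -/
lemma IsWienerIntegral.integral_mul_conj (hM : IsGaussianRandomMeasure P M)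
    (hY : IsWienerIntegral P M f Y) (hZ : IsWienerIntegral P M g Z) (hf : MemLp f 2)
    (hg : MemLp g 2) : ∫ ω, Y ω * conj (Z ω) ∂P = ∫ x, f x * conj (g x) := by
  obtain ⟨hYm, s, hs, hsf, hsY⟩ := hY
  obtain ⟨hZm, s', hs', hsg, hsZ⟩ := hZ
  have hsm : ∀ n, MemLp (s n) 2 volume := fun n =>
    (SimpleFunc.memLp_iff_finMeasSupp (by simp) (by simp)).mpr (hs n)
  have hsm' : ∀ n, MemLp (s' n) 2 volume := fun n =>
    (SimpleFunc.memLp_iff_finMeasSupp (by simp) (by simp)).mpr (hs' n)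
  have h1 := (Lp.tendsto_Lp_iff_tendsto_eLpNorm'' _ hsm _ hf).mpr hsf
  have h2 := (Lp.tendsto_Lp_iff_tendsto_eLpNorm'' _ hsm' _ hg).mpr hsg
  have h3 := (Lp.tendsto_Lp_iff_tendsto_eLpNorm'' _
    (fun n => hM.memLp_simpleIntegral (hs n)) _ hYm).mpr hsY
  have h4 := (Lp.tendsto_Lp_iff_tendsto_eLpNorm'' _
    (fun n => hM.memLp_simpleIntegral (hs' n)) _ hZm).mpr hsZ
  have h5 := h2.inner (𝕜 := ℂ) h1
  have h6 := h4.inner (𝕜 := ℂ) h3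
  simp only [inner_toLp] at h5 h6
  simp only [hM.integral_simpleIntegral_mul_conj (hs _) (hs' _)] at h6
  exact tendsto_nhds_unique h6 h5

/-- The reflected approximants `conj (s n (-ξ))` still converge to `f`, and by the symmetry of `M`
their integrals are the conjugates. -/
lemma IsWienerIntegral.conj (hM : IsGaussianRandomMeasure P M) (hY : IsWienerIntegral P M f Y)
    (hfm : AEStronglyMeasurable f) (hf : ∀ ξ, f (-ξ) = conj (f ξ)) :
    IsWienerIntegral P M f fun ω => conj (Y ω) := by
  obtain ⟨hYm, s, hs, hsf, hsY⟩ := hY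
  refine ⟨memLp_star hYm, fun n => reflect (s n), fun n => reflect_finMeasSupp (hs n), ?_, ?_⟩
  · refine hsf.congr fun n => ?_
    have h1 : eLpNorm ((fun ξ => s n ξ - f ξ) ∘ Neg.neg) 2 volume =
        eLpNorm (fun ξ => s n ξ - f ξ) 2 volume :=
      eLpNorm_comp_measurePreserving ((s n).aestronglyMeasurable.sub hfm)
        (Measure.measurePreserving_neg volume)
    rw [← h1]
    refine eLpNorm_congr_norm_ae (Eventually.of_forall fun ξ => ?_)
    rw [Function.comp_apply, reflect_apply, hf, ← RCLike.norm_conj, map_sub, Complex.conj_conj]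
  · refine hsY.congr fun n => ?_
    refine eLpNorm_congr_norm_ae ?_
    filter_upwards [hM.simpleIntegral_reflect (hs n)] with ω hω
    rw [hω, ← map_sub, RCLike.norm_conj]

/-- The Wiener integral of a Hermitian function is real. -/
lemma IsWienerIntegral.ae_eq_re (hM : IsGaussianRandomMeasure P M) (hY : IsWienerIntegral P M f Y)
    (hfm : AEStronglyMeasurable f) (hf : ∀ ξ, f (-ξ) = conj (f ξ)) :
    ∀ᵐ ω ∂P, Y ω = ((Y ω).re : ℂ) := by
  have hY' := hY.conj hM hfm hf
  have hfL := hY.memLp_integrand hfm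
  have h1 := hY.integral_mul_conj hM hY hfL hfL
  have h2 := hY.integral_mul_conj hM hY' hfL hfL
  have h3 := hY'.integral_mul_conj hM hY hfL hfL
  have h4 := hY'.integral_mul_conj hM hY' hfL hfL
  rw [← inner_toLp hY.1 hY.1] at h1
  rw [← inner_toLp hY.1 hY'.1] at h2
  rw [← inner_toLp hY'.1 hY.1] at h3
  rw [← inner_toLp hY'.1 hY'.1] at h4
  -- By the isometry all four inner products equal `∫ f conj f`, so the squared norm of `Y - conj Y`
  -- is zero.
  have h5 : hY.1.toLp Y - hY'.1.toLp _ = 0 := by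
    rw [← inner_self_eq_zero (𝕜 := ℂ), inner_sub_left, inner_sub_right, inner_sub_right, h1, h2, h3,
      h4]
    ring
  have h6 := (MemLp.toLp_eq_toLp_iff _ _).mp (sub_eq_zero.mp h5)
  filter_upwards [h6] with ω hω
  exact (Complex.conj_eq_iff_re.mp hω.symm).symm

/-- Second moments of linear combinations are determined by the Gram matrix. -/
lemma integral_sq_norm_sum {α ι : Type*} [MeasurableSpace α] {μ : Measure α} [Fintype ι]
    {Y : ι → α → ℂ} (hY : ∀ i, MemLp (Y i) 2 μ) (c : ι → ℂ) :
    ((∫ x, ‖∑ i, c i * Y i x‖ ^ 2 ∂μ : ℝ) : ℂ) =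
      ∑ i, ∑ j, c i * conj (c j) * ∫ x, Y i x * conj (Y j x) ∂μ := by
  rw [← integral_complex_ofReal]
  have hpt : ∀ x, ((‖∑ i, c i * Y i x‖ ^ 2 : ℝ) : ℂ) =
      ∑ i, ∑ j, c i * conj (c j) * (Y i x * conj (Y j x)) := by
    intro x
    rw [Complex.ofReal_pow, ← Complex.mul_conj', map_sum, Finset.sum_mul_sum]
    refine Finset.sum_congr rfl fun i _ => Finset.sum_congr rfl fun j _ => ?_
    rw [map_mul]; ring
  have hint : ∀ i j, Integrable (fun x => c i * conj (c j) * (Y i x * conj (Y j x))) μ :=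
    fun i j => (integrable_mul_conj (hY i) (hY j)).const_mul _
  simp_rw [hpt]
  rw [integral_finsetSum _ fun i _ => integrable_finsetSum _ fun j _ => hint i j]
  refine Finset.sum_congr rfl fun i _ => ?_
  rw [integral_finsetSum _ fun j _ => hint i j]
  exact Finset.sum_congr rfl fun j _ => integral_const_mul _ _

/-- Real linear combinations of real parts of Wiener integrals are centered Gaussian. -/
lemma IsWienerIntegral.hasGaussianLaw_sum_re [IsProbabilityMeasure P]
    (hM : IsGaussianRandomMeasure P M) {ι : Type*} [Fintype ι] {f : ι → Space N → ℂ}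
    {Y : ι → Ω → ℂ} (hY : ∀ i, IsWienerIntegral P M (f i) (Y i)) (b : ι → ℝ) :
    HasGaussianLaw (fun ω => ∑ i, b i * (Y i ω).re) P ∧ ∫ ω, ∑ i, b i * (Y i ω).re ∂P = 0 := by
  choose hYm s hs _ hsY using hY
  let Φ : (ι → Lp ℂ 2 P) → Lp ℝ 2 P := fun y => ∑ i, b i • Complex.reCLM.compLpL 2 P (y i)
  have hΦc : Continuous Φ := by fun_prop
  have hΦ : ∀ {W : ι → Ω → ℂ} (hW : ∀ i, MemLp (W i) 2 P),
      Φ (fun i => (hW i).toLp (W i)) =ᵐ[P] fun ω => ∑ i, b i * (W i ω).re := by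
    intro W hW
    have h1 := Lp.coeFn_finsetSum Finset.univ
      fun i => b i • Complex.reCLM.compLpL 2 P ((hW i).toLp (W i))
    have h2 : ∀ᵐ ω ∂P, ∀ i, (b i • Complex.reCLM.compLpL 2 P ((hW i).toLp (W i)) : Lp ℝ 2 P) ω =
        b i * (W i ω).re := by
      rw [ae_all_iff]
      intro i
      filter_upwards [Lp.coeFn_smul (b i) (Complex.reCLM.compLpL 2 P ((hW i).toLp (W i))),
        Complex.reCLM.coeFn_compLpL (p := 2) (μ := P) ((hW i).toLp (W i)),
        (hW i).coeFn_toLp] with ω h3 h4 h5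
      rw [h3, Pi.smul_apply, h4, h5, smul_eq_mul, Complex.reCLM_apply]
    filter_upwards [h1, h2] with ω h1 h2
    rw [h1, Finset.sum_apply]
    exact Finset.sum_congr rfl fun i _ => h2 i
  have hsm := fun n i => hM.memLp_simpleIntegral (hs i n)
  have hlim : Tendsto (fun n => Φ fun i => (hsm n i).toLp _) atTop
      (𝓝 (Φ fun i => (hYm i).toLp (Y i))) :=
    (hΦc.tendsto _).comp (tendsto_pi_nhds.mpr fun i =>
      (Lp.tendsto_Lp_iff_tendsto_eLpNorm'' _ (fun n => hsm n i) _ (hYm i)).mpr (hsY i))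
  have hgauss := map_eq_gaussianReal_of_tendsto_Lp hlim fun n => by
    obtain ⟨h1, h2⟩ := hM.hasGaussianLaw_sum_re (fun i => s i n) (fun i => hs i n) b
    have h3 := hΦ (hsm n)
    exact (map_eq_gaussianReal_iff _).mpr ⟨h1.congr h3.symm, (integral_congr_ae h3).trans h2⟩
  obtain ⟨h1, h2⟩ := (map_eq_gaussianReal_iff _).mp hgauss
  exact ⟨h1.congr (hΦ hYm), (integral_congr_ae (hΦ hYm)).symm.trans h2⟩

end WienerIntegral

/-! ### From the field to the spectral domain. -/

section HarmonizableField

variable {N : ℕ} {E : Matrix (Fin N) (Fin N) ℝ} {ψ : Space N → ℝ}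

lemma isGaussianProcess_of_sum {Ω T : Type*} [MeasurableSpace Ω] {P : Measure Ω} {X : T → Ω → ℝ}
    (hX : ∀ t, AEMeasurable (X t) P)
    (h : ∀ (I : Finset T) (b : I → ℝ), HasGaussianLaw (fun ω => ∑ i, b i * X i ω) P) :
    IsGaussianProcess X P where
  hasGaussianLaw I := by
    classical
    refine ⟨isGaussian_of_isGaussian_map fun L => ?_⟩
    have hm : AEMeasurable (fun ω => I.restrict (X · ω)) P := aemeasurable_pi_lambda _ fun i => hX i
    rw [AEMeasurable.map_map_of_aemeasurable (by fun_prop) hm]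
    convert (h I fun i => L (Pi.single i 1)).isGaussian_map using 2
    ext ω
    rw [Function.comp_apply]
    conv_lhs => rw [pi_eq_sum_univ' (I.restrict (X · ω)), map_sum]
    refine Finset.sum_congr rfl fun i _ => ?_
    rw [map_smul, smul_eq_mul, mul_comm, Finset.restrict]

lemma IsSymmHomogeneous.measurable_harmonizableKernel (hψ : IsSymmHomogeneous E ψ) (t : Space N) :
    Measurable (harmonizableKernel E ψ t) := by
  have h := hψ.continuous.measurable.pow_const (1 + E.trace / 2)
  unfold harmonizableKernel
  fun_prop

lemma IsSymmHomogeneous.harmonizableKernel_neg (hψ : IsSymmHomogeneous E ψ) (t ξ : Space N) :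
    harmonizableKernel E ψ t (-ξ) = conj (harmonizableKernel E ψ t ξ) := by
  rw [harmonizableKernel, harmonizableKernel, map_div₀, map_sub, map_one, ← Complex.exp_conj,
    map_mul, Complex.conj_I, Complex.conj_ofReal, Complex.conj_ofReal, hψ.symm, inner_neg_right,
    Complex.ofReal_neg, mul_neg, neg_mul]

variable {Ω : Type*} {mΩ : MeasurableSpace Ω} {P : Measure Ω} {X : Space N → Ω → ℝ}

lemma IsHarmonizableField.isGaussianProcess [IsProbabilityMeasure P]
    (hX : IsHarmonizableField P E ψ X) :
    IsGaussianProcess X P ∧ ∀ t, ∫ ω, X t ω ∂P = 0 := by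
  obtain ⟨hmeas, M, hM, hY⟩ := hX
  choose Y hY hXY using hY
  constructor
  · refine isGaussianProcess_of_sum (fun t => (hmeas t).aemeasurable) fun I b => ?_
    refine (IsWienerIntegral.hasGaussianLaw_sum_re hM (fun i : I => hY i) b).1.congr ?_
    have : ∀ᵐ ω ∂P, ∀ i : I, X i ω = (Y i ω).re := ae_all_iff.mpr fun i => hXY i
    filter_upwards [this] with ω hω
    exact Finset.sum_congr rfl fun i _ => by rw [hω]
  · intro t
    rw [integral_congr_ae (hXY t)]
    simpa using (IsWienerIntegral.hasGaussianLaw_sum_re hM (fun _ : Unit => hY t) fun _ => 1).2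

lemma IsHarmonizableField.integral_sq_sub_sum [IsProbabilityMeasure P]
    (hψ : IsSymmHomogeneous E ψ) (hX : IsHarmonizableField P E ψ X) {κ : Type*} [Fintype κ]
    (y : Space N) (x : κ → Space N) (a : κ → ℝ) :
    MemLp (fun ξ => harmonizableKernel E ψ y ξ -
      ∑ k, (a k : ℂ) * harmonizableKernel E ψ (x k) ξ) 2 ∧
    ∫ ω, (X y ω - ∑ k, a k * X (x k) ω) ^ 2 ∂P =
      ∫ ξ, ‖harmonizableKernel E ψ y ξ -
        ∑ k, (a k : ℂ) * harmonizableKernel E ψ (x k) ξ‖ ^ 2 := by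
  obtain ⟨hmeas, M, hM, hY⟩ := hX
  choose Y hY hXY using hY
  have hf : ∀ t, MemLp (harmonizableKernel E ψ t) 2 volume := fun t =>
    (hY t).memLp_integrand (hψ.measurable_harmonizableKernel t).aestronglyMeasurable
  have hreal : ∀ t, ∀ᵐ ω ∂P, Y t ω = (X t ω : ℂ) := fun t => by
    filter_upwards [hXY t, (hY t).ae_eq_re hM
      (hψ.measurable_harmonizableKernel t).aestronglyMeasurable (hψ.harmonizableKernel_neg t)]
      with ω h1 h2
    rw [h1, ← h2]
  refine ⟨(hf y).sub (memLp_finsetSum _ fun k _ => (hf _).const_mul _), ?_⟩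
  -- The residual becomes one linear combination, with `none` carrying `y` with coefficient `1`;
  -- both sides then agree because their Gram matrices do.
  let p : Option κ → Space N := fun o => o.elim y x
  let c : Option κ → ℂ := fun o => o.elim 1 fun k => -(a k : ℂ)
  have h1 := integral_sq_norm_sum (fun o => (hY (p o)).1) c
  have h2 := integral_sq_norm_sum (fun o => hf (p o)) c
  simp only [(hY _).integral_mul_conj hM (hY _) (hf _) (hf _)] at h1
  rw [← h2, Complex.ofReal_inj] at h1
  simp only [Fintype.sum_option, p, c, Option.elim_none, Option.elim_some, one_mul, neg_mul,
    Finset.sum_neg_distrib, ← sub_eq_add_neg] at h1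
  rw [← h1]
  have hall : ∀ᵐ ω ∂P, ∀ k, Y (x k) ω = (X (x k) ω : ℂ) := ae_all_iff.mpr fun k => hreal _
  refine integral_congr_ae ?_
  filter_upwards [hreal y, hall] with ω h3 h4
  simp only [h3, h4]
  rw [← sq_abs, ← Real.norm_eq_abs, ← Complex.norm_real]
  push_cast
  rfl

/-- The conditional variance of a harmonizable field is bounded below by the distance, in the
spectral domain, from the kernel to the real span of the other kernels. -/
lemma IsHarmonizableField.le_condVar [IsProbabilityMeasure P] (hψ : IsSymmHomogeneous E ψ)
    (hX : IsHarmonizableField P E ψ X) {κ : Type*} [Fintype κ] (y : Space N) (x : κ → Space N)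
    {B : ℝ} (hB : ∀ a : κ → ℝ, MemLp (fun ξ => harmonizableKernel E ψ y ξ -
        ∑ k, (a k : ℂ) * harmonizableKernel E ψ (x k) ξ) 2 →
      B ≤ ∫ ξ, ‖harmonizableKernel E ψ y ξ -
        ∑ k, (a k : ℂ) * harmonizableKernel E ψ (x k) ξ‖ ^ 2) :
    ∀ᵐ ω ∂P, B ≤
      Var[X y; P | MeasurableSpace.comap (fun ω k => X (x k) ω) inferInstance] ω := by
  obtain ⟨hG, hcent⟩ := hX.isGaussianProcess
  have hmem : ∀ t, MemLp (X t) 2 P := fun t => (hG.hasGaussianLaw_eval t).memLp_two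
  have hinner : ∀ s t, inner ℝ ((hmem s).toLp (X s)) ((hmem t).toLp (X t)) =
      ∫ ω, X s ω * X t ω ∂P := by
    intro s t
    rw [L2.inner_def]
    refine integral_congr_ae ?_
    filter_upwards [(hmem s).coeFn_toLp, (hmem t).coeFn_toLp] with ω h1 h2
    rw [h1, h2, RCLike.inner_apply, mul_comm]
    rfl
  obtain ⟨a, ha⟩ := exists_sub_sum_orthogonal ((hmem y).toLp (X y))
    fun k => (hmem (x k)).toLp (X (x k))
  have horth : ∀ k, ∫ ω, X (x k) ω * (X y ω - ∑ j, a j * X (x j) ω) ∂P = 0 := by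
    intro k
    have hprod : ∀ s t, Integrable (fun ω => X s ω * X t ω) P := fun s t =>
      (hmem s).integrable_mul (hmem t)
    have h1 := ha k
    simp only [inner_sub_right, inner_sum, inner_smul_right, hinner] at h1
    have h2 : ∀ ω, X (x k) ω * (X y ω - ∑ j, a j * X (x j) ω) =
        X (x k) ω * X y ω - ∑ j, a j * (X (x k) ω * X (x j) ω) := fun ω => by
      rw [mul_sub, Finset.mul_sum]
      congr 1
      exact Finset.sum_congr rfl fun j _ => by ring
    simp_rw [h2]
    rw [integral_sub (hprod _ _) (integrable_finsetSum _ fun j _ => (hprod _ _).const_mul _),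
      integral_finsetSum _ fun j _ => (hprod _ _).const_mul _]
    simpa only [integral_const_mul] using h1
  obtain ⟨h1, h2⟩ := hX.integral_sq_sub_sum hψ y x a
  filter_upwards [condVar_ae_eq_of_isGaussianProcess hG hX.1 hcent x y a horth] with ω hω
  rw [hω, h2]
  exact hB a h1

lemma condVar_nonneg (m : MeasurableSpace Ω) (Y : Ω → ℝ) : ∀ᵐ ω ∂P, 0 ≤ Var[Y; P | m] ω :=
  condExp_nonneg (Eventually.of_forall fun _ => sq_nonneg _)

end HarmonizableField

end OperatorScaling

/-! ### The main theorem. -/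

open OperatorScaling in
theorem theorem3p1 {N : ℕ} (E : Matrix (Fin N) (Fin N) ℝ) (hE : EigenvaluesReGtOne E) :
    (∃ ν : Seminorm ℝ (Space N), IsPolarNorm E ν) ∧
    ∀ (ν : Seminorm ℝ (Space N)), IsPolarNorm E ν →
    ∀ (ψ : Space N → ℝ), IsSymmHomogeneous E ψ →
    ∃ C₅ : ℝ, 0 < C₅ ∧
      ∀ {Ω : Type*} [MeasurableSpace Ω] (P : Measure Ω) [IsProbabilityMeasure P]
        (X : Space N → Ω → ℝ), IsHarmonizableField P E ψ X →
      ∀ (n : ℕ) (hn : 2 ≤ n) (t : ℕ → Space N), t 0 = 0 →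
        ∀ᵐ ω ∂P,
          C₅ * (Finset.range n).inf' (Finset.nonempty_range_iff.mpr (by omega))
              (fun k => tau E ν (t n - t k) ^ 2)
            ≤ Var[X (t n); P | pastSigma X t n] ω := by
  obtain ⟨T, hT0, hT⟩ := hE.exists_norm_flow_le_half
  refine ⟨⟨_, isPolarNorm_averagedNorm hT0 hT⟩, fun ν _ ψ hψ => ?_⟩
  obtain ⟨ε, hε, hετ⟩ := exists_le_norm_of_le_tau hE ν
  rcases subsingleton_or_nontrivial (Space N) with hsub | hnt
  -- In dimension zero there are no unit vectors, so `τ` vanishes identically.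
  · refine ⟨1, one_pos, fun P _ X hX n hn t ht0 => ?_⟩
    filter_upwards [condVar_nonneg (P := P) (pastSigma X t n) (X (t n))] with ω hω
    refine le_trans ?_ hω
    obtain ⟨k, hk, hkeq⟩ := Finset.exists_mem_eq_inf'
      (Finset.nonempty_range_iff.mpr (by omega : n ≠ 0)) fun k => tau E ν (t n - t k) ^ 2
    rw [hkeq]
    rcases tau_eq_zero_or (E := E) (ν := ν) (t n - t k) with h | ⟨-, θ, hθ, -⟩
    · simp [h]
    · rw [Subsingleton.elim θ 0, map_zero] at hθ
      exact absurd hθ zero_ne_one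
  · have : Nonempty (Fin N) := by
      by_contra h
      rw [not_nonempty_iff] at h
      exact not_subsingleton (Space N) inferInstance
    have htr : 0 < E.trace := trace_pos E fun μ hμ => zero_lt_one.trans (hE μ hμ)
    obtain ⟨C, hC0, hC⟩ := exists_mul_sq_le_integral_kernel hE hψ htr.le hε
    refine ⟨C, hC0, fun P _ X hX n hn t ht0 => ?_⟩
    -- The scale is `r = τ(t^n - t^{k₀})` for a minimizing `k₀`; if `r = 0`, nonnegativity of the
    -- conditional variance is enough.
    obtain ⟨k₀, hk₀, hkeq⟩ := Finset.exists_mem_eq_inf'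
      (Finset.nonempty_range_iff.mpr (by omega : n ≠ 0)) fun k => tau E ν (t n - t k) ^ 2
    have hle : ∀ k < n, tau E ν (t n - t k₀) ≤ tau E ν (t n - t k) := fun k hk => by
      refine le_of_sq_le_sq ?_ (tau_nonneg _)
      rw [← hkeq]
      exact Finset.inf'_le (fun k => tau E ν (t n - t k) ^ 2) (Finset.mem_range.mpr hk)
    rw [hkeq]
    rcases (tau_nonneg (E := E) (ν := ν) (t n - t k₀)).eq_or_lt with h0 | hpos
    · filter_upwards [condVar_nonneg (P := P) (pastSigma X t n) (X (t n))] with ω hω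
      simpa [← h0] using hω
    · refine hX.le_condVar hψ (t n) (fun k : Finset.Ico 1 n => t k) fun a ha => ?_
      have h := hC Finset.univ (fun k : Finset.Ico 1 n => (a k : ℂ)) (fun k => t k) (t n)
        (Real.log (tau E ν (t n - t k₀))) ?_ ?_ ha
      · rwa [Real.exp_log hpos] at h
      -- The index `k = 0`, where `t^0 = 0`, supplies the condition on `y` itself that handles the
      -- `-1` in the kernels.
      · have := hετ _ hpos _ (hle 0 (by omega))
        rwa [ht0, sub_zero] at this
      · intro k _
        exact hετ _ hpos _ (hle k (Finset.mem_Ico.mp k.2).2)
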